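/- \textbf{Setting.} Let $k>0$ and $\alpha\in\mathbb R$, put $\alpha_j:=j+\alpha$ and assume $k^2\neq\alpha_j^2$ for all $j\in\mathbb Z$. Let $\beta_j:=(k^2-\alpha_j^2)^{1/2}$, with $\beta_j>0$ if $\alpha_j^2<k^2$ and $\beta_j\in i(0,\infty)$ if $\alpha_j^2>k^2$, and let $$G_{k,\alpha}(x):=\frac{i}{4\pi}\sum_{j\in\mathbb Z}\frac1{\beta_j}\exp(i\alpha_jx_1+i\beta_j|x_2|)$$ be the $\alpha$-quasi-periodic Green's function. Let $D\subset(-\pi,\pi)\times(-\rho,\rho)$ be open, for some $\rho>0$. Denote by $H^1_\alpha(D)$ the space of all $u\in H^1(D)$ of the form $u=U|_D$ with some $U\in H^1_{\rm loc}(\mathbb R^2)$ such that $U(x_1+2\pi,x_2)=e^{2\pi i\alpha}U(x_1,x_2)$. For $g\in L^2(D,\mathbb C^2)$ let $$L_kg:=\operatorname{div}V_kg,\qquad V_kg(x):=\int_DG_{k,\alpha}(x-y)g(y)\,dy,$$ with the divergence in the weak sense in $D$. Let $Q\in L^\infty(D,\mathbb C^{2\times2})$ be such that, for almost every $x\in D$,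 the matrix $\operatorname{Re}Q(x)=\frac12(Q(x)+Q(x)^*)$ is either positive definite or negative definite (which of the two may depend on $x$, and no uniform bound is assumed). Let $H^1_{\alpha,Q}(D)$ be the completion of $H^1_\alpha(D)$ in the norm $$\|u\|^2_{H^1_{\alpha,Q}(D)}:=\big\||\operatorname{Re}Q|^{1/2}\nabla u\big\|^2_{L^2(D,\mathbb C^2)}+\|u\|^2_{L^2(D)}.$$ For $v\in H^1_{\alpha,Q}(D)$ the gradient $\nabla v$ is the measurable field, unique almost everywhere in $D$, for which $|\operatorname{Re}Q|^{1/2}\nabla v$ is the $L^2$-limit of $|\operatorname{Re}Q|^{1/2}\nabla u_n$ whenever $u_n\in H^1_\alpha(D)$ and $u_n\to v$ in $H^1_{\alpha,Q}(D)$. \textbf{Proposition.} The operator $L_k$ is well defined from $L^2(D,\mathbb C^2)$ into $H^1_\alpha(D)$. Let $f\in L^2(D,\mathbb C^2)$ and consider the Lippmann--Schwinger equation $u=L_k(Q\nabla u+f)$. (i) If $u\in H^1_\alpha(D)$ satisfies it in $H^1_\alpha(D)$, then the image of $u$ in $H^1_{\alpha,Q}(D)$ satisfies it in $H^1_{\alpha,Q}(D)$.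 (ii) Conversely, if $v\in H^1_{\alpha,Q}(D)$ satisfies it in $H^1_{\alpha,Q}(D)$ (that is, $Q\nabla v\in L^2(D,\mathbb C^2)$ and $v$ is the image of $L_k(Q\nabla v+f)$), then $v$ is the image of some $u\in H^1_\alpha(D)$ that satisfies it in $H^1_\alpha(D)$. The requirement $Q\nabla v\in L^2(D,\mathbb C^2)$ holds for every $v\in H^1_{\alpha,Q}(D)$ if there is $C>0$ with $|\operatorname{Im}Q(x)\xi|\le C|\operatorname{Re}Q(x)\xi|$ for almost every $x\in D$ and all $\xi\in\mathbb C^2$, where $\operatorname{Im}Q=\frac1{2i}(Q-Q^*)$. -/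

import Mathlib

open MeasureTheory Set
open scoped ContDiff ENNReal

noncomputable section

namespace Grating

/-- The value space `ℂ²` with its Euclidean norm. -/
abbrev C2 : Type := EuclideanSpace ℂ (Fin 2)

/-- `L²(D)`. Points of the plane are pairs `x = (x₁, x₂)`. -/
abbrev L2 (D : Set (ℝ × ℝ)) : Type := Lp ℂ 2 (volume.restrict D)

/-- `L²(D, ℂ²)`. -/
abbrev L2v (D : Set (ℝ × ℝ)) : Type := Lp C2 2 (volume.restrict D)

/-! ### Quasi-periodic Sobolev spaces -/

/-- `φ` is a (real valued) test function with compact support in the open set `D`. -/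
structure IsTest (D : Set (ℝ × ℝ)) (φ : ℝ × ℝ → ℝ) : Prop where
  smooth : ContDiff ℝ ∞ φ
  compact : HasCompactSupport φ
  supp : tsupport φ ⊆ D

/-- `∂φ/∂x₁`. -/
def d1 (φ : ℝ × ℝ → ℝ) (x : ℝ × ℝ) : ℝ := fderiv ℝ φ x (1, 0)

/-- `∂φ/∂x₂`. -/
def d2 (φ : ℝ × ℝ → ℝ) (x : ℝ × ℝ) : ℝ := fderiv ℝ φ x (0, 1)

/-- `f` is square integrable on all compact sets. -/
def IsL2Loc {E : Type*} [NormedAddCommGroup E] (f : ℝ × ℝ → E) : Prop :=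
  ∀ K : Set (ℝ × ℝ), IsCompact K → MemLp f 2 (volume.restrict K)

/-- `U ∈ H¹_loc(ℝ²)` with weak gradient `P`. -/
structure IsH1Loc (U : ℝ × ℝ → ℂ) (P : ℝ × ℝ → C2) : Prop where
  fn : IsL2Loc U
  grad : IsL2Loc P
  weak1 : ∀ φ, IsTest univ φ → ∫ x, d1 φ x • U x = -∫ x, φ x • P x 0
  weak2 : ∀ φ, IsTest univ φ → ∫ x, d2 φ x • U x = -∫ x, φ x • P x 1

/-- `U` is `α`-quasi-periodic in `x₁`:  `U(x₁ + 2π, x₂) = exp(2πiα) U(x₁, x₂)`. -/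
def IsQuasiPeriodic (α : ℝ) (U : ℝ × ℝ → ℂ) : Prop :=
  ∀ᵐ x : ℝ × ℝ, U (x.1 + 2 * Real.pi, x.2) = Complex.exp (2 * Real.pi * Complex.I * α) * U x

theorem IsTest.continuous_d1 {D : Set (ℝ × ℝ)} {φ : ℝ × ℝ → ℝ} (h : IsTest D φ) :
    Continuous (d1 φ) :=
  (h.smooth.continuous_fderiv (by simp)).clm_apply continuous_const

theorem IsTest.continuous_d2 {D : Set (ℝ × ℝ)} {φ : ℝ × ℝ → ℝ} (h : IsTest D φ) :
    Continuous (d2 φ) :=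
  (h.smooth.continuous_fderiv (by simp)).clm_apply continuous_const

theorem IsTest.compact_d1 {D : Set (ℝ × ℝ)} {φ : ℝ × ℝ → ℝ} (h : IsTest D φ) :
    HasCompactSupport (d1 φ) :=
  (h.compact.fderiv (𝕜 := ℝ)).comp_left (g := fun L : ℝ × ℝ →L[ℝ] ℝ => L (1, 0)) rfl

theorem IsTest.compact_d2 {D : Set (ℝ × ℝ)} {φ : ℝ × ℝ → ℝ} (h : IsTest D φ) :
    HasCompactSupport (d2 φ) :=
  (h.compact.fderiv (𝕜 := ℝ)).comp_left (g := fun L : ℝ × ℝ →L[ℝ] ℝ => L (0, 1)) rfl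

theorem IsL2Loc.locallyIntegrable {E : Type*} [NormedAddCommGroup E] {f : ℝ × ℝ → E}
    (h : IsL2Loc f) : LocallyIntegrable f := by
  rw [locallyIntegrable_iff]
  intro K hK
  have : IsFiniteMeasure (volume.restrict K : Measure (ℝ × ℝ)) :=
    ⟨by simpa using hK.measure_lt_top⟩
  exact (h K hK).integrable (by norm_num)

theorem IsL2Loc.comp {f : ℝ × ℝ → C2} (h : IsL2Loc f) (i : Fin 2) :
    IsL2Loc (fun x => f x i) := fun K hK =>
  (EuclideanSpace.proj (𝕜 := ℂ) i).comp_memLp' (h K hK)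

theorem integrable_test {g : ℝ × ℝ → ℝ} (hg : Continuous g) (hc : HasCompactSupport g)
    {f : ℝ × ℝ → ℂ} (hf : IsL2Loc f) : Integrable (fun x => g x • f x) :=
  hf.locallyIntegrable.integrable_smul_left_of_hasCompactSupport hg hc

theorem IsH1Loc.add {U V : ℝ × ℝ → ℂ} {P R : ℝ × ℝ → C2} (h : IsH1Loc U P) (h' : IsH1Loc V R) :
    IsH1Loc (fun x => U x + V x) (fun x => P x + R x) where
  fn := fun K hK => (h.fn K hK).add (h'.fn K hK)
  grad := fun K hK => (h.grad K hK).add (h'.grad K hK)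
  weak1 := fun φ hφ => by
    have e1 := h.weak1 φ hφ
    have e2 := h'.weak1 φ hφ
    simp only [smul_add, PiLp.add_apply]
    rw [integral_add (integrable_test hφ.continuous_d1 hφ.compact_d1 h.fn)
        (integrable_test hφ.continuous_d1 hφ.compact_d1 h'.fn),
      integral_add (integrable_test hφ.smooth.continuous hφ.compact (h.grad.comp 0))
        (integrable_test hφ.smooth.continuous hφ.compact (h'.grad.comp 0)), e1, e2]
    ring
  weak2 := fun φ hφ => by
    have e1 := h.weak2 φ hφ
    have e2 := h'.weak2 φ hφ
    simp only [smul_add, PiLp.add_apply]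
    rw [integral_add (integrable_test hφ.continuous_d2 hφ.compact_d2 h.fn)
        (integrable_test hφ.continuous_d2 hφ.compact_d2 h'.fn),
      integral_add (integrable_test hφ.smooth.continuous hφ.compact (h.grad.comp 1))
        (integrable_test hφ.smooth.continuous hφ.compact (h'.grad.comp 1)), e1, e2]
    ring

theorem IsH1Loc.smul {U : ℝ × ℝ → ℂ} {P : ℝ × ℝ → C2} (h : IsH1Loc U P) (c : ℂ) :
    IsH1Loc (fun x => c • U x) (fun x => c • P x) where
  fn := fun K hK => (h.fn K hK).const_smul c
  grad := fun K hK => (h.grad K hK).const_smul c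
  weak1 := fun φ hφ => by
    simp only [PiLp.smul_apply, smul_comm _ c, integral_smul, h.weak1 φ hφ, smul_neg]
  weak2 := fun φ hφ => by
    simp only [PiLp.smul_apply, smul_comm _ c, integral_smul, h.weak2 φ hφ, smul_neg]

/-- The space `H¹_α(D)` for an open set `D`: the restrictions `u = U|_D` of the `α`-quasi-periodic
functions `U ∈ H¹_loc(ℝ²)` that belong to `H¹(D)`. An element is stored as the pair `(u, ∇u)` of
`u ∈ L²(D)` and its weak gradient `∇u = ∇U|_D ∈ L²(D, ℂ²)`, which is determined by `u`; the norm
inherited from the `ℓ²`-product is the norm of `H¹(D)`. -/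
def H1Sub (D : Set (ℝ × ℝ)) (α : ℝ) : Submodule ℂ (WithLp 2 (L2 D × L2v D)) where
  carrier := {u | ∃ U P, IsH1Loc U P ∧ IsQuasiPeriodic α U ∧
    (∀ᵐ x ∂(volume.restrict D), u.fst x = U x) ∧ (∀ᵐ x ∂(volume.restrict D), u.snd x = P x)}
  add_mem' := by
    rintro u v ⟨U, P, h1, h2, h3, h4⟩ ⟨V, R, k1, k2, k3, k4⟩
    refine ⟨_, _, h1.add k1, ?_, ?_, ?_⟩
    · filter_upwards [h2, k2] with x hx kx
      rw [hx, kx]; ring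
    · filter_upwards [h3, k3, Lp.coeFn_add u.fst v.fst] with x hx kx e
      rw [WithLp.add_fst, e, Pi.add_apply, hx, kx]
    · filter_upwards [h4, k4, Lp.coeFn_add u.snd v.snd] with x hx kx e
      rw [WithLp.add_snd, e, Pi.add_apply, hx, kx]
  zero_mem' := by
    refine ⟨fun _ => 0, fun _ => 0, ⟨fun K _ => MemLp.zero', fun K _ => MemLp.zero', ?_, ?_⟩,
      ?_, ?_, ?_⟩
    · simp
    · simp
    · simp [IsQuasiPeriodic]
    · exact Lp.coeFn_zero _ _ _
    · exact Lp.coeFn_zero _ _ _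
  smul_mem' := by
    rintro c u ⟨U, P, h1, h2, h3, h4⟩
    refine ⟨_, _, h1.smul c, ?_, ?_, ?_⟩
    · filter_upwards [h2] with x hx
      rw [hx]; simp only [smul_eq_mul]; ring
    · filter_upwards [h3, Lp.coeFn_smul c u.fst] with x hx e
      rw [WithLp.smul_fst, e, Pi.smul_apply, hx]
    · filter_upwards [h4, Lp.coeFn_smul c u.snd] with x hx e
      rw [WithLp.smul_snd, e, Pi.smul_apply, hx]

/-- `H¹_α(D)` as a type. -/
abbrev H1 (D : Set (ℝ × ℝ)) (α : ℝ) : Type := H1Sub D α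

/-- The function `u ∈ L²(D)` underlying an element of `H¹_α(D)`. -/
def H1.fn {D : Set (ℝ × ℝ)} {α : ℝ} (u : H1 D α) : L2 D := u.1.fst

/-- The weak gradient `∇u ∈ L²(D, ℂ²)` of an element of `H¹_α(D)`. -/
def H1.grad {D : Set (ℝ × ℝ)} {α : ℝ} (u : H1 D α) : L2v D := u.1.snd

/-! ### The quasi-periodic Green's function and the operator `L_k = div V_k` -/

/-- `α_j = j + α`. -/
def alphaJ (α : ℝ) (j : ℤ) : ℝ := j + α

/-- `β_j = (k² - α_j²)^{1/2}`, the root being nonnegative or having positive imaginary part. -/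
def betaJ (k α : ℝ) (j : ℤ) : ℂ :=
  if alphaJ α j ^ 2 ≤ k ^ 2 then (√(k ^ 2 - alphaJ α j ^ 2) : ℂ)
  else Complex.I * (√(alphaJ α j ^ 2 - k ^ 2) : ℂ)

/-- The `α`-quasi-periodic Green's function
`G(x) = i/(4π) ∑_j β_j⁻¹ exp(i α_j x₁ + i β_j |x₂|)`; the series converges absolutely for all `x`
with `x₂ ≠ 0`, that is, almost everywhere, and only these values enter below. -/
def green (k α : ℝ) (x : ℝ × ℝ) : ℂ :=
  Complex.I / (4 * Real.pi) * ∑' j : ℤ, (betaJ k α j)⁻¹ *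
    Complex.exp (Complex.I * alphaJ α j * x.1 + Complex.I * betaJ k α j * |x.2|)

/-- The volume potential `(V_k g)(x) = ∫_D G(x - y) g(y) dy`, componentwise. -/
def volPot (k α : ℝ) (D : Set (ℝ × ℝ)) (g : L2v D) (x : ℝ × ℝ) : C2 :=
  ∫ y in D, green k α (x - y) • g y

/-- `w = L_k g` in `H¹_α(D)`, where `L_k g = div V_k g`: the function `w ∈ H¹_α(D)` is the weak
divergence of the volume potential `V_k g` in `D`. -/
structure IsLk (k α : ℝ) (D : Set (ℝ × ℝ)) (g : L2v D) (w : H1 D α) : Prop where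
  locInt : LocallyIntegrableOn (volPot k α D g) D
  weakDiv : ∀ φ, IsTest D φ → ∫ x in D, φ x • w.fn x =
    -∫ x in D, (d1 φ x • volPot k α D g x 0 + d2 φ x • volPot k α D g x 1)

/-! ### The contrast and the weighted space -/

/-- `Re A = (A + A*)/2`. -/
def reM (A : Matrix (Fin 2) (Fin 2) ℂ) : Matrix (Fin 2) (Fin 2) ℂ :=
  (2⁻¹ : ℂ) • (A + A.conjTranspose)

/-- `Im A = (A - A*)/(2i)`. -/
def imM (A : Matrix (Fin 2) (Fin 2) ℂ) : Matrix (Fin 2) (Fin 2) ℂ :=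
  (2 * Complex.I)⁻¹ • (A - A.conjTranspose)

/-- The matrix `A` applied to a vector of `ℂ²`. -/
def act (A : Matrix (Fin 2) (Fin 2) ℂ) (ξ : C2) : C2 := Matrix.toEuclideanCLM (𝕜 := ℂ) A ξ

/-- `|Re A|^{1/2}`, through the spectral calculus of the Hermitian matrix `Re A`. -/
def sqrtAbsRe (A : Matrix (Fin 2) (Fin 2) ℂ) : Matrix (Fin 2) (Fin 2) ℂ :=
  cfc (fun t : ℝ => √|t|) (reM A)

section
open scoped ComplexOrder

/-- A contrast `Q ∈ L^∞(D, ℂ^{2×2})` such that `Re Q(x)` is strictly positive definite or strictly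
negative definite at almost every `x ∈ D` (which of the two may depend on `x`, and there need not
be a uniform bound away from zero). -/
structure Contrast (D : Set (ℝ × ℝ)) where
  toFun : ℝ × ℝ → Matrix (Fin 2) (Fin 2) ℂ
  meas : ∀ i j, AEStronglyMeasurable (fun x => toFun x i j) (volume.restrict D)
  bdd : ∃ M : ℝ, ∀ᵐ x ∂(volume.restrict D), ∀ i j, ‖toFun x i j‖ ≤ M
  definite : ∀ᵐ x ∂(volume.restrict D), (reM (toFun x)).PosDef ∨ (-reM (toFun x)).PosDef

end

theorem isSelfAdjoint_reM (A : Matrix (Fin 2) (Fin 2) ℂ) : IsSelfAdjoint (reM A) := by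
  rw [isSelfAdjoint_iff, Matrix.star_eq_conjTranspose, reM]
  simp [Matrix.conjTranspose_smul, add_comm]

theorem continuous_act : Continuous fun z : Matrix (Fin 2) (Fin 2) ℂ × C2 => act z.1 z.2 := by
  refine (PiLp.continuous_toLp 2 _).comp ?_
  exact continuous_fst.matrix_mulVec ((PiLp.continuous_ofLp 2 _).comp continuous_snd)

section
open scoped Matrix.Norms.L2Operator

theorem continuous_sqrtAbsRe : Continuous sqrtAbsRe := by
  have h : Continuous reM := by
    unfold reM
    fun_prop
  exact Continuous.cfc_of_mem_nhdsSet (s := univ) (fun t : ℝ => √|t|) Filter.univ_mem h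
    (fun A => isSelfAdjoint_reM A) (by fun_prop)

theorem norm_act_le (A : Matrix (Fin 2) (Fin 2) ℂ) (ξ : C2) : ‖act A ξ‖ ≤ ‖A‖ * ‖ξ‖ :=
  (Matrix.toEuclideanCLM (𝕜 := ℂ) A).le_opNorm ξ

theorem exists_bound_sqrtAbsRe (M : ℝ) : ∃ c : ℝ, ∀ A : Matrix (Fin 2) (Fin 2) ℂ,
    (∀ i j, ‖A i j‖ ≤ M) → ∀ ξ, ‖act (sqrtAbsRe A) ξ‖ ≤ c * ‖ξ‖ := by
  have hK : IsCompact (univ.pi fun _ : Fin 2 => univ.pi fun _ : Fin 2 =>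
      Metric.closedBall (0 : ℂ) M) :=
    isCompact_univ_pi fun _ => isCompact_univ_pi fun _ => isCompact_closedBall _ _
  obtain ⟨c, hc⟩ := IsCompact.exists_bound_of_continuousOn (E := Matrix (Fin 2) (Fin 2) ℂ)
    (α := Matrix (Fin 2) (Fin 2) ℂ) hK continuous_sqrtAbsRe.continuousOn
  refine ⟨c, fun A hA ξ => (norm_act_le _ _).trans ?_⟩
  refine mul_le_mul_of_nonneg_right (hc A ?_) (norm_nonneg _)
  exact fun i _ j _ => by simpa using hA i j

end

theorem continuous_sqrtAbsRe' : Continuous sqrtAbsRe := continuous_sqrtAbsRe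

theorem Contrast.aestronglyMeasurable {D : Set (ℝ × ℝ)} (Q : Contrast D) :
    AEStronglyMeasurable Q.toFun (volume.restrict D) := by
  have h : AEMeasurable (β := Fin 2 → Fin 2 → ℂ) Q.toFun (volume.restrict D) :=
    aemeasurable_pi_lambda (X := fun _ : Fin 2 => Fin 2 → ℂ) _ fun i =>
      aemeasurable_pi_lambda (X := fun _ : Fin 2 => ℂ) _ fun j => (Q.meas i j).aemeasurable
  exact h.aestronglyMeasurable

theorem Contrast.aestronglyMeasurable_sqrt {D : Set (ℝ × ℝ)} (Q : Contrast D) :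
    AEStronglyMeasurable (fun x => sqrtAbsRe (Q.toFun x)) (volume.restrict D) :=
  continuous_sqrtAbsRe'.comp_aestronglyMeasurable Q.aestronglyMeasurable

theorem aestronglyMeasurable_act {μ : Measure (ℝ × ℝ)} {A : ℝ × ℝ → Matrix (Fin 2) (Fin 2) ℂ}
    {p : ℝ × ℝ → C2} (hA : AEStronglyMeasurable A μ) (hp : AEStronglyMeasurable p μ) :
    AEStronglyMeasurable (fun x => act (A x) (p x)) μ := by
  have h := hA.prodMk hp
  have h' := Continuous.comp_aestronglyMeasurable (g := fun z : _ × C2 => act z.1 z.2)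
    continuous_act h
  exact h'

theorem Contrast.exists_bound {D : Set (ℝ × ℝ)} (Q : Contrast D) (p : L2v D) :
    ∃ c : ℝ, ∀ᵐ x ∂(volume.restrict D),
      ‖act (sqrtAbsRe (Q.toFun x)) (p x)‖ ≤ c * ‖p x‖ :=
  Q.bdd.elim fun M hM => (exists_bound_sqrtAbsRe M).elim fun c hc =>
    ⟨c, hM.mono fun _ hx => hc _ hx _⟩

theorem Contrast.memLp {D : Set (ℝ × ℝ)} (Q : Contrast D) (p : L2v D) :
    MemLp (fun x => act (sqrtAbsRe (Q.toFun x)) (p x)) 2 (volume.restrict D) :=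
  (Q.exists_bound p).elim fun _ hc =>
    MemLp.of_le_mul (Lp.memLp p) (aestronglyMeasurable_act Q.aestronglyMeasurable_sqrt (Lp.aestronglyMeasurable p)) hc

/-- The map `u ↦ (u, |Re Q|^{1/2} ∇u)` from `H¹_α(D)` to `L²(D) × L²(D, ℂ²)`. -/
def weightMap {D : Set (ℝ × ℝ)} (α : ℝ) (Q : Contrast D) :
    H1 D α →ₗ[ℂ] WithLp 2 (L2 D × L2v D) where
  toFun u := WithLp.toLp 2 (u.fn, (Q.memLp u.grad).toLp _)
  map_add' u v := by
    refine congrArg (WithLp.toLp 2) (Prod.ext rfl ?_)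
    apply Lp.ext
    filter_upwards [(Q.memLp (u + v).grad).coeFn_toLp, (Q.memLp u.grad).coeFn_toLp,
      (Q.memLp v.grad).coeFn_toLp, Lp.coeFn_add u.grad v.grad,
      Lp.coeFn_add ((Q.memLp u.grad).toLp _) ((Q.memLp v.grad).toLp _)] with x h1 h2 h3 h4 h5
    refine h1.trans (Eq.trans ?_ h5.symm)
    rw [Pi.add_apply, h2, h3, show (u + v).grad = u.grad + v.grad from rfl, h4]
    exact map_add (Matrix.toEuclideanCLM (𝕜 := ℂ) (sqrtAbsRe (Q.toFun x))) _ _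
  map_smul' c u := by
    refine congrArg (WithLp.toLp 2) (Prod.ext rfl ?_)
    apply Lp.ext
    filter_upwards [(Q.memLp (c • u).grad).coeFn_toLp, (Q.memLp u.grad).coeFn_toLp,
      Lp.coeFn_smul c u.grad, Lp.coeFn_smul c ((Q.memLp u.grad).toLp _)] with x h1 h2 h3 h4
    refine h1.trans (Eq.trans ?_ h4.symm)
    rw [Pi.smul_apply, h2, show (c • u).grad = c • u.grad from rfl, h3]
    exact map_smul (Matrix.toEuclideanCLM (𝕜 := ℂ) (sqrtAbsRe (Q.toFun x))) _ _

/-- The vector space `H¹_α(D)` under the weighted norm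
`‖u‖² = ‖|Re Q|^{1/2} ∇u‖²_{L²(D, ℂ²)} + ‖u‖²_{L²(D)}`. -/
def PreH1Q {D : Set (ℝ × ℝ)} (α : ℝ) (_Q : Contrast D) : Type := H1 D α

instance {D : Set (ℝ × ℝ)} (α : ℝ) (Q : Contrast D) : AddCommGroup (PreH1Q α Q) :=
  inferInstanceAs (AddCommGroup (H1 D α))

instance {D : Set (ℝ × ℝ)} (α : ℝ) (Q : Contrast D) : Module ℂ (PreH1Q α Q) :=
  inferInstanceAs (Module ℂ (H1 D α))

/-- `weightMap`, on the copy of `H¹_α(D)` that carries the weighted norm. -/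
def preWeightMap {D : Set (ℝ × ℝ)} (α : ℝ) (Q : Contrast D) :
    PreH1Q α Q →ₗ[ℂ] WithLp 2 (L2 D × L2v D) := weightMap α Q

instance {D : Set (ℝ × ℝ)} (α : ℝ) (Q : Contrast D) : SeminormedAddCommGroup (PreH1Q α Q) :=
  SeminormedAddCommGroup.induced _ _ (preWeightMap α Q)

instance {D : Set (ℝ × ℝ)} (α : ℝ) (Q : Contrast D) : NormedSpace ℂ (PreH1Q α Q) :=
  NormedSpace.induced ℂ _ _ (preWeightMap α Q)

theorem norm_sq_preH1Q {D : Set (ℝ × ℝ)} (α : ℝ) (Q : Contrast D) (u : H1 D α) :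
    ‖(show PreH1Q α Q from u)‖ ^ 2 = ‖(Q.memLp u.grad).toLp _‖ ^ 2 + ‖u.fn‖ ^ 2 := by
  rw [add_comm]
  exact WithLp.prod_norm_sq_eq_of_L2 (weightMap α Q u)

/-- The weighted space `H¹_{α,Q}(D)`: the completion of `H¹_α(D)` in the weighted norm. -/
abbrev H1Q {D : Set (ℝ × ℝ)} (α : ℝ) (Q : Contrast D) : Type :=
  UniformSpace.Completion (PreH1Q α Q)

/-- The canonical embedding of `H¹_α(D)` into `H¹_{α,Q}(D)`. -/
def H1.toH1Q {D : Set (ℝ × ℝ)} {α : ℝ} (Q : Contrast D) (u : H1 D α) : H1Q α Q :=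
  ((show PreH1Q α Q from u : PreH1Q α Q) : UniformSpace.Completion (PreH1Q α Q))

/-- The isometric extension of `u ↦ (u, |Re Q|^{1/2} ∇u)` to `H¹_{α,Q}(D)`. -/
def weightMapQ {D : Set (ℝ × ℝ)} (α : ℝ) (Q : Contrast D) :
    H1Q α Q →L[ℂ] WithLp 2 (L2 D × L2v D) :=
  ((preWeightMap α Q).mkContinuous 1 fun u => by rw [one_mul]; exact le_rfl).fromCompletion

/-- The gradient of `v ∈ H¹_{α,Q}(D)`: the measurable field `∇v`, unique almost everywhere in
`D`, such that `|Re Q|^{1/2} ∇v` is the limit in `L²(D, ℂ²)` of `|Re Q|^{1/2} ∇u_n` whenever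
`u_n ∈ H¹_α(D)` and `u_n → v` in `H¹_{α,Q}(D)`. (The matrix is invertible almost everywhere.) -/
def gradQ {D : Set (ℝ × ℝ)} {α : ℝ} {Q : Contrast D} (v : H1Q α Q) (x : ℝ × ℝ) : C2 :=
  act (sqrtAbsRe (Q.toFun x))⁻¹ ((weightMapQ α Q v).snd x)

/-! ### Solutions of the Lippmann–Schwinger equation -/

/-- `u ∈ H¹_α(D)` solves `u = L_k(Q∇u + f)` in `H¹_α(D)`. -/
def SolvesH1 {D : Set (ℝ × ℝ)} {α : ℝ} (k : ℝ) (Q : Contrast D) (f : L2v D) (u : H1 D α) :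
    Prop :=
  ∃ g : L2v D, (∀ᵐ x ∂(volume.restrict D), g x = act (Q.toFun x) (u.grad x) + f x) ∧
    IsLk k α D g u

/-- `v ∈ H¹_{α,Q}(D)` solves `v = L_k(Q∇v + f)` in `H¹_{α,Q}(D)`: the field `Q∇v + f` lies in
`L²(D, ℂ²)`, and `v` is the image in `H¹_{α,Q}(D)` of the element `L_k(Q∇v + f)` of `H¹_α(D)`. -/
def SolvesH1Q {D : Set (ℝ × ℝ)} {α : ℝ} (k : ℝ) (Q : Contrast D) (f : L2v D) (v : H1Q α Q) :
    Prop :=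
  ∃ g : L2v D, (∀ᵐ x ∂(volume.restrict D), g x = act (Q.toFun x) (gradQ v x) + f x) ∧
    ∃ w : H1 D α, IsLk k α D g w ∧ v = w.toH1Q Q

end Grating

end

/-!
For `g ∈ L²(D, ℂ²)` the volume potential `V_k g` is the series over `j ∈ ℤ` of the modes
`exp(iα_j x₁) (ĝ_j * κ_j)(x₂)`, where `ĝ_j` is the `j`-th quasi-periodic Fourier coefficient of `g`
in `x₁` and `κ_j(t) = i/(4π) exp(iβ_j |t|) / β_j`. The coefficients of the second derivatives are
bounded by multiples of `j² |ĝ_j| * |κ_j|` and `|ĝ_j|`. Since `β_j` behaves like `i|j|`, the `L¹`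
norm of `κ_j` is `O(j⁻²)`, so by Schur's test these coefficients are square summable. Such series
converge in `L²` of a finite measure that is locally equivalent to Lebesgue measure and for which
the characters stay orthogonal, so `L_k g` is the restriction of a quasi-periodic function in
`H¹_loc(ℝ²)`.

The weak divergence determines the function `L_k g` almost everywhere, hence also its gradient.
Since `|Re Q|^{1/2}` is invertible almost everywhere, the weighted gradient of the image of
`u ∈ H¹_α(D)` is `∇u`, and both notions of a solution have the same right-hand side. Finally,
`‖(Re Q) ξ‖ = ‖|Re Q|^{1/2} |Re Q|^{1/2} ξ‖` and the boundedness of `|Re Q|^{1/2}` control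
`‖Q ξ‖` by `‖|Re Q|^{1/2} ξ‖` if `Im Q` is dominated by `Re Q`.
-/

noncomputable section

open scoped Real Convolution
open ContinuousLinearMap (mul)

namespace Grating

/-! ### A finite measure for which the characters are orthogonal -/

/-- The measure `∑_L 2^{-(L+1)} dx|_(-Lπ, Lπ)` on the line. It is finite and locally equivalent to
Lebesgue measure, and the characters `exp(inx)`, `n ∈ ℤ`, are orthogonal with respect to it. -/
def lineMeas : Measure ℝ :=
  Measure.sum fun L : ℕ => ((2 : ℝ≥0∞)⁻¹ ^ (L + 1)) • volume.restrict (Ioo (-(L * π)) (L * π))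

theorem lineMeas_le_volume : lineMeas ≤ volume := by
  refine Measure.le_iff.2 fun s hs => ?_
  rw [lineMeas, Measure.sum_apply _ hs]
  calc ∑' L : ℕ, (((2 : ℝ≥0∞)⁻¹ ^ (L + 1)) • volume.restrict (Ioo (-(L * π)) (L * π))) s
      ≤ ∑' L : ℕ, (2 : ℝ≥0∞)⁻¹ ^ (L + 1) * volume s := by
        refine ENNReal.tsum_le_tsum fun L => ?_
        rw [Measure.smul_apply, smul_eq_mul]
        exact mul_le_mul_right (Measure.restrict_apply_le _ _) _
    _ = volume s := by
        rw [ENNReal.tsum_mul_right, ENNReal.tsum_geometric_add_one, ENNReal.one_sub_inv_two,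
          inv_inv, ENNReal.inv_mul_cancel two_ne_zero ENNReal.ofNat_ne_top, one_mul]

theorem restrict_Ioo_le_lineMeas (L : ℕ) :
    volume.restrict (Ioo (-(L * π)) (L * π)) ≤ ((2 : ℝ≥0∞) ^ (L + 1)) • lineMeas := by
  calc volume.restrict (Ioo (-(L * π)) (L * π))
      = (2 : ℝ≥0∞) ^ (L + 1) • (2 : ℝ≥0∞)⁻¹ ^ (L + 1) •
          volume.restrict (Ioo (-(L * π)) (L * π)) := by
        rw [smul_smul, ← mul_pow, ENNReal.mul_inv_cancel two_ne_zero ENNReal.ofNat_ne_top,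
          one_pow, one_smul]
    _ ≤ (2 : ℝ≥0∞) ^ (L + 1) • lineMeas := by
        gcongr
        exact Measure.le_sum (fun L : ℕ => ((2 : ℝ≥0∞)⁻¹ ^ (L + 1)) •
          volume.restrict (Ioo (-(L * π)) (L * π))) L

instance : IsFiniteMeasure lineMeas := by
  have mass_eq (L : ℕ) : (((2 : ℝ≥0∞)⁻¹ ^ (L + 1)) •
      (volume : Measure ℝ).restrict (Ioo (-(L * π)) (L * π))) univ =
      ENNReal.ofReal (π * ((L : ℝ) ^ 1 * (2⁻¹ : ℝ) ^ L)) := by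
    rw [Measure.smul_apply, Measure.restrict_apply_univ, Real.volume_Ioo, smul_eq_mul,
      show (2 : ℝ≥0∞)⁻¹ = ENNReal.ofReal 2⁻¹ by
        rw [ENNReal.ofReal_inv_of_pos two_pos, ENNReal.ofReal_ofNat],
      ← ENNReal.ofReal_pow (by positivity), ← ENNReal.ofReal_mul (by positivity)]
    ring_nf
  have summable_mass : Summable fun L : ℕ => (L : ℝ) ^ 1 * (2⁻¹ : ℝ) ^ L :=
    summable_pow_mul_geometric_of_norm_lt_one 1 (by norm_num)
  refine ⟨?_⟩
  rw [lineMeas, Measure.sum_apply _ MeasurableSet.univ]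
  simp_rw [mass_eq]
  exact (summable_mass.mul_left π).tsum_ofReal_ne_top.lt_top

theorem norm_exp_I_mul_mul (a x : ℝ) : ‖Complex.exp (Complex.I * a * x)‖ = 1 := by
  rw [mul_assoc, ← Complex.ofReal_mul, Complex.norm_exp_I_mul_ofReal]

theorem integral_exp_lineMeas {n : ℤ} (hn : n ≠ 0) :
    ∫ x : ℝ, Complex.exp (Complex.I * n * x) ∂lineMeas = 0 := by
  have integrable_exp : Integrable (fun x : ℝ => Complex.exp (Complex.I * n * x)) lineMeas := by
    refine Integrable.of_bound (C := 1) (by fun_prop) (.of_forall fun x => ?_)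
    simpa using (norm_exp_I_mul_mul n x).le
  rw [lineMeas] at integrable_exp ⊢
  rw [integral_sum_measure integrable_exp]
  refine (tsum_congr fun L => ?_).trans tsum_zero
  have exp_periodic : Complex.exp (Complex.I * n * ((L * π : ℝ) : ℂ)) =
      Complex.exp (Complex.I * n * ((-(L * π) : ℝ) : ℂ)) := by
    rw [Complex.exp_eq_exp_iff_exists_int]
    refine ⟨n * L, ?_⟩
    push_cast
    ring
  rw [integral_smul_measure, ← integral_Ioc_eq_integral_Ioo,
    ← intervalIntegral.integral_of_le (neg_le_self (by positivity)),
    integral_exp_mul_complex (by simpa using hn), exp_periodic, sub_self, zero_div, smul_zero]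

/-- The product of `lineMeas` with itself, a finite measure on the plane that is locally
equivalent to Lebesgue measure. -/
def planeMeas : Measure (ℝ × ℝ) := lineMeas.prod lineMeas

theorem exists_subset_Ioo_prod_Ioo {K : Set (ℝ × ℝ)} (hK : IsCompact K) :
    ∃ R : ℝ, K ⊆ Ioo (-R) R ×ˢ Ioo (-R) R := by
  obtain ⟨R, hR⟩ := hK.isBounded.subset_ball 0
  refine ⟨R, fun x hx => ?_⟩
  have := hR hx
  rwa [mem_ball_zero_iff, Prod.norm_def, max_lt_iff, Real.norm_eq_abs, Real.norm_eq_abs,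
    abs_lt, abs_lt] at this

theorem exists_restrict_le_smul_planeMeas {K : Set (ℝ × ℝ)} (hK : IsCompact K) :
    ∃ c : ℝ≥0∞, c ≠ ⊤ ∧ volume.restrict K ≤ c • planeMeas := by
  obtain ⟨R, hR⟩ := exists_subset_Ioo_prod_Ioo hK
  obtain ⟨L, hL⟩ := exists_nat_gt R
  set J : Set ℝ := Ioo (-(L * π)) (L * π)
  have hRL : R ≤ L * π := by
    nlinarith [Real.pi_gt_three, (Nat.cast_nonneg L : (0 : ℝ) ≤ L)]
  have hRJ : Ioo (-R) R ⊆ J := Ioo_subset_Ioo (neg_le_neg hRL) hRL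
  have : SFinite ((2 : ℝ≥0∞) ^ (L + 1) • lineMeas) := inferInstance
  refine ⟨(2 : ℝ≥0∞) ^ (L + 1) * 2 ^ (L + 1), by finiteness, ?_⟩
  calc volume.restrict K ≤ volume.restrict (J ×ˢ J) :=
        Measure.restrict_mono (hR.trans (prod_mono hRJ hRJ)) le_rfl
    _ = (volume.restrict J).prod (volume.restrict J) := (Measure.prod_restrict J J).symm
    _ ≤ ((2 : ℝ≥0∞) ^ (L + 1) • lineMeas).prod ((2 : ℝ≥0∞) ^ (L + 1) • lineMeas) :=
        Measure.prod_mono (restrict_Ioo_le_lineMeas L) (restrict_Ioo_le_lineMeas L)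
    _ = ((2 : ℝ≥0∞) ^ (L + 1) * 2 ^ (L + 1)) • planeMeas := by
        rw [Measure.prod_smul_left, Measure.prod_smul_right, smul_smul, planeMeas]

theorem isL2Loc_of_memLp_planeMeas {E : Type*} [NormedAddCommGroup E] {F : ℝ × ℝ → E}
    (hF : MemLp F 2 planeMeas) : IsL2Loc F := fun _ hK =>
  let ⟨_, hc, hle⟩ := exists_restrict_le_smul_planeMeas hK
  hF.of_measure_le_smul hc hle

theorem volume_absolutelyContinuous_planeMeas :
    (volume : Measure (ℝ × ℝ)) ≪ planeMeas := by
  refine Measure.ae_le_iff_absolutelyContinuous.1 fun s hs => ?_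
  change ∀ᵐ x, x ∈ s
  rw [← Measure.restrict_univ (μ := (volume : Measure (ℝ × ℝ))),
    ← Metric.iUnion_closedBall_nat (0 : ℝ × ℝ), ae_restrict_iUnion_iff]
  intro n
  obtain ⟨c, -, hle⟩ := exists_restrict_le_smul_planeMeas (isCompact_closedBall (0 : ℝ × ℝ) n)
  exact (Measure.absolutelyContinuous_of_le_smul hle).ae_le hs

theorem exists_clm_eq_integral_smul {ψ : ℝ × ℝ → ℝ} (hψ : Continuous ψ) (hc : HasCompactSupport ψ) :
    ∃ T : Lp ℂ 2 planeMeas →L[ℝ] ℂ, ∀ F, T F = ∫ x, ψ x • F x := by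
  obtain ⟨c, hc_ne, hle⟩ := exists_restrict_le_smul_planeMeas hc
  obtain ⟨M, hM⟩ := hψ.bounded_above_of_compact_support hc
  have : IsFiniteMeasure ((volume : Measure (ℝ × ℝ)).restrict (tsupport ψ)) :=
    isFiniteMeasure_restrict.2 hc.isCompact.measure_ne_top
  have memLp_ψ : MemLp (fun x => (ψ x : ℂ)) 2 (volume.restrict (tsupport ψ)) :=
    MemLp.of_bound (by fun_prop) M (.of_forall fun x => by simpa using hM x)
  refine ⟨((innerSL ℂ (memLp_ψ.toLp _)).restrictScalars ℝ).comp
    (Lp.LpToLpOfMeasureLeSMul hc_ne hle), fun F => ?_⟩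
  calc inner ℂ (memLp_ψ.toLp _) (Lp.LpToLpOfMeasureLeSMul hc_ne hle F)
      = ∫ x in tsupport ψ, ψ x • F x := by
        rw [L2.inner_def]
        refine integral_congr_ae ?_
        filter_upwards [memLp_ψ.coeFn_toLp, Lp.coeFn_LpToLpOfMeasureLeSMul hc_ne hle F]
          with x hψx hFx
        rw [hψx, hFx, RCLike.inner_apply, Complex.conj_ofReal, Complex.real_smul, mul_comm]
    _ = ∫ x, ψ x • F x :=
        setIntegral_eq_integral_of_forall_compl_eq_zero fun x hx => by
          rw [image_eq_zero_of_notMem_tsupport hx, zero_smul]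

/-! ### Fourier modes -/

theorem summable_of_inner_eq_zero {𝕜 ι E : Type*} [RCLike 𝕜] [NormedAddCommGroup E]
    [InnerProductSpace 𝕜 E] [CompleteSpace E] {f : ι → E}
    (ho : Pairwise fun i j => inner 𝕜 (f i) (f j) = 0) (hs : Summable fun i => ‖f i‖ ^ 2) :
    Summable f := by
  have orthogonalFamily_span : OrthogonalFamily 𝕜 (fun i => (𝕜 ∙ f i : Submodule 𝕜 E))
      fun i => (𝕜 ∙ f i : Submodule 𝕜 E).subtypeₗᵢ := by
    intro i j hij v w
    obtain ⟨a, ha⟩ := Submodule.mem_span_singleton.1 v.2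
    obtain ⟨b, hb⟩ := Submodule.mem_span_singleton.1 w.2
    simp [← ha, ← hb, inner_smul_left, inner_smul_right, ho hij]
  exact (orthogonalFamily_span.summable_iff_norm_sq_summable
    fun i => ⟨f i, Submodule.mem_span_singleton_self _⟩).2 hs

/-- The function `x ↦ exp(i a x₁) u(x₂)` on the plane. -/
def mode (a : ℝ) (u : ℝ → ℂ) (x : ℝ × ℝ) : ℂ := Complex.exp (Complex.I * a * x.1) * u x.2

theorem norm_mode (a : ℝ) (u : ℝ → ℂ) (x : ℝ × ℝ) : ‖mode a u x‖ = ‖u x.2‖ := by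
  rw [mode, norm_mul, norm_exp_I_mul_mul, one_mul]

theorem mode_const_mul (a : ℝ) (c : ℂ) (u : ℝ → ℂ) (x : ℝ × ℝ) :
    mode a (fun t => c * u t) x = c * mode a u x :=
  mul_left_comm _ _ _

theorem mode_quasiPeriodic (α : ℝ) (j : ℤ) (u : ℝ → ℂ) (x : ℝ × ℝ) :
    mode (alphaJ α j) u (x.1 + 2 * π, x.2) =
      Complex.exp (2 * π * Complex.I * α) * mode (alphaJ α j) u x := by
  rw [mode, mode, ← mul_assoc, ← Complex.exp_add]
  congr 1
  rw [Complex.exp_eq_exp_iff_exists_int]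
  refine ⟨j, ?_⟩
  simp only [alphaJ]
  push_cast
  ring

theorem memLp_mode {u : ℝ → ℂ} (hu : MemLp u 2 lineMeas) (a : ℝ) :
    MemLp (mode a u) 2 planeMeas := by
  have memLp_snd : MemLp (fun x : ℝ × ℝ => u x.2) 2 planeMeas := hu.comp_snd lineMeas
  exact memLp_snd.of_le (AEStronglyMeasurable.mul (by fun_prop) memLp_snd.1)
    (.of_forall fun x => (norm_mode a u x).le)

theorem inner_mode {u v : ℝ → ℂ} (hu : MemLp u 2 lineMeas) (hv : MemLp v 2 lineMeas) (a b : ℝ) :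
    inner ℂ ((memLp_mode hu a).toLp _) ((memLp_mode hv b).toLp _) =
      (∫ x : ℝ, Complex.exp (Complex.I * (b - a : ℝ) * x) ∂lineMeas) *
        ∫ t, v t * star (u t) ∂lineMeas := by
  rw [L2.inner_def, ← integral_prod_mul]
  refine integral_congr_ae ?_
  filter_upwards [(memLp_mode hu a).coeFn_toLp, (memLp_mode hv b).coeFn_toLp] with x hux hvx
  rw [hux, hvx, mode, mode]
  simp only [RCLike.inner_apply, map_mul, ← Complex.exp_conj, Complex.conj_I, Complex.conj_ofReal]
  rw [show Complex.I * ((b - a : ℝ) : ℂ) * x.1 = Complex.I * b * x.1 + -Complex.I * a * x.1 by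
    push_cast; ring, Complex.exp_add, RCLike.star_def]
  ring

theorem norm_mode_toLp_sq {u : ℝ → ℂ} (hu : MemLp u 2 lineMeas) (a : ℝ) :
    ‖(memLp_mode hu a).toLp _‖ ^ 2 = lineMeas.real univ * ∫ t, ‖u t‖ ^ 2 ∂lineMeas := by
  have mul_star_eq (t : ℝ) : u t * star (u t) = ((‖u t‖ ^ 2 : ℝ) : ℂ) := by
    rw [RCLike.star_def, Complex.mul_conj', Complex.ofReal_pow]
  have inner_eq := inner_mode hu hu a a
  simp only [inner_self_eq_norm_sq_to_K, sub_self, mul_star_eq, integral_complex_ofReal,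
    Complex.ofReal_zero, mul_zero, zero_mul, Complex.exp_zero, integral_const, Complex.real_smul,
    mul_one] at inner_eq
  refine Complex.ofReal_injective ?_
  rw [Complex.ofReal_mul, Complex.ofReal_pow]
  exact inner_eq

theorem summable_mode (α : ℝ) {u : ℤ → ℝ → ℂ} (hu : ∀ j, MemLp (u j) 2 lineMeas)
    (hs : Summable fun j => ∫ t, ‖u j t‖ ^ 2 ∂lineMeas) :
    Summable fun j => (memLp_mode (hu j) (alphaJ α j)).toLp _ := by
  refine summable_of_inner_eq_zero (𝕜 := ℂ) (fun i j hij => ?_) ?_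
  · have integral_eq := integral_exp_lineMeas (sub_ne_zero.2 hij.symm)
    change inner ℂ _ _ = 0
    rw [inner_mode (hu i) (hu j), show alphaJ α j - alphaJ α i = ((j - i : ℤ) : ℝ) by
      simp only [alphaJ]; push_cast; ring, Complex.ofReal_intCast, integral_eq, zero_mul]
  · exact (hs.mul_left _).congr fun j => (norm_mode_toLp_sq (hu j) _).symm

/-! ### Weak derivatives of modes -/

/-- `v` is the weak derivative of `u` on the line. -/
def HasWeakDeriv (u v : ℝ → ℂ) : Prop :=
  ∀ ψ : ℝ → ℝ, ContDiff ℝ ∞ ψ → HasCompactSupport ψ →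
    ∫ t, deriv ψ t • u t = -∫ t, ψ t • v t

/-- The distributional derivative of `u` is `v + c δ₀`, with the Dirac measure `δ₀` at `0`. -/
def HasJumpDeriv (u v : ℝ → ℂ) (c : ℂ) : Prop :=
  ∀ ψ : ℝ → ℝ, ContDiff ℝ ∞ ψ → HasCompactSupport ψ →
    ∫ t, deriv ψ t • u t = -(ψ 0 • c) - ∫ t, ψ t • v t

theorem HasWeakDeriv.add {u v u' v' : ℝ → ℂ} (h : HasWeakDeriv u v) (h' : HasWeakDeriv u' v')
    (hu : LocallyIntegrable u) (hv : LocallyIntegrable v)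
    (hu' : LocallyIntegrable u') (hv' : LocallyIntegrable v') :
    HasWeakDeriv (fun t => u t + u' t) (fun t => v t + v' t) := by
  intro ψ hψ hc
  have integrable_smul {f : ℝ → ℂ} (hf : LocallyIntegrable f) : Integrable fun t => ψ t • f t :=
    hf.integrable_smul_left_of_hasCompactSupport hψ.continuous hc
  have integrable_deriv_smul {f : ℝ → ℂ} (hf : LocallyIntegrable f) :
      Integrable fun t => deriv ψ t • f t :=
    hf.integrable_smul_left_of_hasCompactSupport (hψ.continuous_deriv (by simp)) hc.deriv
  simp only [smul_add]
  rw [integral_add (integrable_deriv_smul hu) (integrable_deriv_smul hu'),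
    integral_add (integrable_smul hv) (integrable_smul hv'), h ψ hψ hc, h' ψ hψ hc, neg_add]

theorem HasWeakDeriv.const_mul {u v : ℝ → ℂ} (h : HasWeakDeriv u v) (c : ℂ) :
    HasWeakDeriv (fun t => c * u t) (fun t => c * v t) := by
  intro ψ hψ hc
  simp only [← smul_eq_mul, smul_comm _ c, integral_smul, h ψ hψ hc, smul_neg]

theorem contDiff_smul_and_deriv_eq {ψ : ℝ → ℝ} (hψ : ContDiff ℝ ∞ ψ) {f f' : ℝ → ℂ}
    (hf : ∀ t, HasDerivAt f (f' t) t) (hf' : Continuous f') :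
    ContDiff ℝ 1 (fun t => ψ t • f t) ∧
      deriv (fun t => ψ t • f t) = fun t => ψ t • f' t + deriv ψ t • f t := by
  have hasDerivAt_smul (t : ℝ) :
      HasDerivAt (fun t => ψ t • f t) (ψ t • f' t + deriv ψ t • f t) t :=
    (hψ.differentiable (by simp) t).hasDerivAt.smul (hf t)
  have deriv_eq := funext fun t => (hasDerivAt_smul t).deriv
  have continuous_f : Continuous f := continuous_iff_continuousAt.2 fun t => (hf t).continuousAt
  refine ⟨contDiff_one_iff_deriv.2 ⟨fun t => (hasDerivAt_smul t).differentiableAt, ?_⟩, deriv_eq⟩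
  rw [deriv_eq]
  exact (hψ.continuous.smul hf').add ((hψ.continuous_deriv (by simp)).smul continuous_f)

theorem setIntegral_deriv_smul {ψ : ℝ → ℝ} (hψ : ContDiff ℝ ∞ ψ) (hc : HasCompactSupport ψ)
    {f f' : ℝ → ℂ} (hf : ∀ t, HasDerivAt f (f' t) t) (hf' : Continuous f') (s : Set ℝ) :
    ∫ t in s, deriv ψ t • f t =
      (∫ t in s, deriv (fun t => ψ t • f t) t) - ∫ t in s, ψ t • f' t := by
  have continuous_f : Continuous f := continuous_iff_continuousAt.2 fun t => (hf t).continuousAt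
  have integrable_smul : Integrable fun t => ψ t • f' t :=
    hf'.locallyIntegrable.integrable_smul_left_of_hasCompactSupport hψ.continuous hc
  have integrable_deriv_smul : Integrable fun t => deriv ψ t • f t :=
    continuous_f.locallyIntegrable.integrable_smul_left_of_hasCompactSupport
      (hψ.continuous_deriv (by simp)) hc.deriv
  rw [(contDiff_smul_and_deriv_eq hψ hf hf').2,
    integral_add integrable_smul.integrableOn integrable_deriv_smul.integrableOn,
    add_sub_cancel_left]

theorem integral_smul_ite {ψ : ℝ → ℝ} (hψ : Continuous ψ) (hc : HasCompactSupport ψ)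
    {f g : ℝ → ℂ} (hf : Continuous f) (hg : Continuous g) :
    ∫ t, ψ t • (if 0 < t then f t else g t) =
      (∫ t in Ioi 0, ψ t • f t) + ∫ t in Iic 0, ψ t • g t := by
  have integrable_smul {u : ℝ → ℂ} (hu : Continuous u) : Integrable fun t => ψ t • u t :=
    hu.locallyIntegrable.integrable_smul_left_of_hasCompactSupport hψ hc
  have := integral_piecewise (s := Ioi (0 : ℝ)) measurableSet_Ioi
    (integrable_smul hf).integrableOn (integrable_smul hg).integrableOn
  rw [compl_Ioi] at this
  rw [← this]
  refine integral_congr_ae (.of_forall fun t => ?_)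
  simp only [smul_ite, piecewise, mem_Ioi]

theorem hasJumpDeriv_ite {f f' g g' : ℝ → ℂ} (hf : ∀ t, HasDerivAt f (f' t) t)
    (hf' : Continuous f') (hg : ∀ t, HasDerivAt g (g' t) t) (hg' : Continuous g') :
    HasJumpDeriv (fun t => if 0 < t then f t else g t) (fun t => if 0 < t then f' t else g' t)
      (f 0 - g 0) := by
  intro ψ hψ hc
  have continuous_f : Continuous f := continuous_iff_continuousAt.2 fun t => (hf t).continuousAt
  have continuous_g : Continuous g := continuous_iff_continuousAt.2 fun t => (hg t).continuousAt
  have hc_smul (u : ℝ → ℂ) : HasCompactSupport fun t => ψ t • u t := hc.smul_right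
  rw [integral_smul_ite (hψ.continuous_deriv (by simp)) hc.deriv continuous_f continuous_g,
    integral_smul_ite hψ.continuous hc hf' hg', setIntegral_deriv_smul hψ hc hf hf',
    setIntegral_deriv_smul hψ hc hg hg',
    (hc_smul f).integral_Ioi_deriv_eq (contDiff_smul_and_deriv_eq hψ hf hf').1,
    (hc_smul g).integral_Iic_deriv_eq (contDiff_smul_and_deriv_eq hψ hg hg').1, smul_sub]
  ring

theorem hasWeakDeriv_of_hasDerivAt {f f' : ℝ → ℂ} (hf : ∀ t, HasDerivAt f (f' t) t)
    (hf' : Continuous f') : HasWeakDeriv f f' := by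
  simpa only [HasWeakDeriv, HasJumpDeriv, ite_self, sub_self, smul_zero, neg_zero, zero_sub]
    using hasJumpDeriv_ite hf hf' hf hf'

theorem hasDerivAt_exp_mul (c : ℂ) (t : ℝ) :
    HasDerivAt (fun t : ℝ => Complex.exp (c * t)) (c * Complex.exp (c * t)) t := by
  simpa [mul_comm] using ((hasDerivAt_id (t : ℂ)).const_mul c).cexp.comp_ofReal

theorem IsTest.slice_fst {φ : ℝ × ℝ → ℝ} (h : IsTest univ φ) (t : ℝ) :
    ContDiff ℝ ∞ (fun s => φ (s, t)) ∧ HasCompactSupport (fun s => φ (s, t)) ∧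
      ∀ s, deriv (fun s => φ (s, t)) s = d1 φ (s, t) := by
  refine ⟨h.smooth.comp (contDiff_id.prodMk contDiff_const),
    HasCompactSupport.intro (h.compact.isCompact.image continuous_fst) fun s hs =>
      image_eq_zero_of_notMem_tsupport fun hx => hs ⟨_, hx, rfl⟩, fun s => ?_⟩
  have hasFDerivAt := (h.smooth.differentiable (by simp) (s, t)).hasFDerivAt
  exact (hasFDerivAt.comp_hasDerivAt s ((hasDerivAt_id s).prodMk (hasDerivAt_const s t))).deriv

theorem IsTest.slice_snd {φ : ℝ × ℝ → ℝ} (h : IsTest univ φ) (s : ℝ) :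
    ContDiff ℝ ∞ (fun t => φ (s, t)) ∧ HasCompactSupport (fun t => φ (s, t)) ∧
      ∀ t, deriv (fun t => φ (s, t)) t = d2 φ (s, t) := by
  refine ⟨h.smooth.comp (contDiff_const.prodMk contDiff_id),
    HasCompactSupport.intro (h.compact.isCompact.image continuous_snd) fun t ht =>
      image_eq_zero_of_notMem_tsupport fun hx => ht ⟨_, hx, rfl⟩, fun t => ?_⟩
  have hasFDerivAt := (h.smooth.differentiable (by simp) (s, t)).hasFDerivAt
  exact (hasFDerivAt.comp_hasDerivAt t ((hasDerivAt_const t s).prodMk (hasDerivAt_id t))).deriv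

theorem integral_d1_mode {φ : ℝ × ℝ → ℝ} (hφ : IsTest univ φ) {u : ℝ → ℂ}
    (hu : MemLp u 2 lineMeas) (a : ℝ) :
    ∫ x, d1 φ x • mode a u x = -∫ x, φ x • (Complex.I * a * mode a u x) := by
  have integrable_left := integrable_test hφ.continuous_d1 hφ.compact_d1
    (isL2Loc_of_memLp_planeMeas (memLp_mode hu a))
  have integrable_right := integrable_test hφ.smooth.continuous hφ.compact
    (isL2Loc_of_memLp_planeMeas ((memLp_mode hu a).const_mul (Complex.I * a)))
  have hasWeakDeriv_exp := hasWeakDeriv_of_hasDerivAt (hasDerivAt_exp_mul (Complex.I * a))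
    (by fun_prop)
  rw [Measure.volume_eq_prod] at integrable_left integrable_right ⊢
  rw [integral_prod_symm _ integrable_left, integral_prod_symm _ integrable_right, ← integral_neg]
  refine integral_congr_ae (.of_forall fun t => ?_)
  obtain ⟨smooth_slice, compact_slice, deriv_slice⟩ := hφ.slice_fst t
  have := congrArg (· * u t) (hasWeakDeriv_exp _ smooth_slice compact_slice)
  simp only [deriv_slice, neg_mul, ← integral_mul_const, smul_mul_assoc] at this
  simpa only [mode, mul_assoc] using this

theorem integral_d2_mode {φ : ℝ × ℝ → ℝ} (hφ : IsTest univ φ) {u v : ℝ → ℂ}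
    (hu : MemLp u 2 lineMeas) (hv : MemLp v 2 lineMeas) (huv : HasWeakDeriv u v) (a : ℝ) :
    ∫ x, d2 φ x • mode a u x = -∫ x, φ x • mode a v x := by
  have integrable_left := integrable_test hφ.continuous_d2 hφ.compact_d2
    (isL2Loc_of_memLp_planeMeas (memLp_mode hu a))
  have integrable_right := integrable_test hφ.smooth.continuous hφ.compact
    (isL2Loc_of_memLp_planeMeas (memLp_mode hv a))
  rw [Measure.volume_eq_prod] at integrable_left integrable_right ⊢
  rw [integral_prod _ integrable_left, integral_prod _ integrable_right, ← integral_neg]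
  refine integral_congr_ae (.of_forall fun s => ?_)
  obtain ⟨smooth_slice, compact_slice, deriv_slice⟩ := hφ.slice_snd s
  have := congrArg (Complex.exp (Complex.I * a * s) * ·) (huv _ smooth_slice compact_slice)
  simp only [deriv_slice, mul_neg, ← integral_const_mul, mul_smul_comm] at this
  simpa only [mode] using this

/-! ### One-dimensional convolutions -/

theorem aestronglyMeasurable_convolution {h κ : ℝ → ℂ} (hh : Integrable h) (hκ : Measurable κ) :
    AEStronglyMeasurable (h ⋆[mul ℂ ℂ] κ) :=
  (hh.1.convolution_integrand (mul ℂ ℂ) hκ.aestronglyMeasurable).integral_prod_right'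

theorem norm_convolution_le {h κ : ℝ → ℂ} {M : ℝ} (hh : Integrable h) (hM : ∀ t, ‖κ t‖ ≤ M)
    (t : ℝ) : ‖(h ⋆[mul ℂ ℂ] κ) t‖ ≤ ∫ s, ‖h s‖ * M := by
  rw [convolution_mul]
  refine norm_integral_le_of_norm_le (hh.norm.mul_const M) (.of_forall fun s => ?_)
  rw [norm_mul]
  exact mul_le_mul_of_nonneg_left (hM _) (norm_nonneg _)

theorem memLp_convolution {h κ : ℝ → ℂ} {M : ℝ} (hh : Integrable h) (hκ : Measurable κ)
    (hM : ∀ t, ‖κ t‖ ≤ M) : MemLp (h ⋆[mul ℂ ℂ] κ) 2 lineMeas :=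
  MemLp.of_bound ((aestronglyMeasurable_convolution hh hκ).mono_measure lineMeas_le_volume) _
    (.of_forall fun t => norm_convolution_le hh hM t)

theorem locallyIntegrable_convolution {h κ : ℝ → ℂ} {M : ℝ} (hh : Integrable h)
    (hκ : Measurable κ) (hM : ∀ t, ‖κ t‖ ≤ M) : LocallyIntegrable (h ⋆[mul ℂ ℂ] κ) := by
  rw [locallyIntegrable_iff]
  intro K hK
  have : IsFiniteMeasure ((volume : Measure ℝ).restrict K) := ⟨by simpa using hK.measure_lt_top⟩
  exact Integrable.of_bound (aestronglyMeasurable_convolution hh hκ).restrict _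
    (.of_forall fun t => norm_convolution_le hh hM t)

theorem integrable_prod_smul_mul_sub {h κ : ℝ → ℂ} {M : ℝ} {ψ : ℝ → ℝ} (hh : Integrable h)
    (hκ : Measurable κ) (hM : ∀ t, ‖κ t‖ ≤ M) (hψ : Integrable ψ) :
    Integrable fun p : ℝ × ℝ => ψ p.1 • (h p.2 * κ (p.1 - p.2)) := by
  refine ((hψ.ofReal.mul_prod hh).mul_bdd (g := fun p : ℝ × ℝ => κ (p.1 - p.2)) (c := M)
    (hκ.comp (by fun_prop)).aestronglyMeasurable (.of_forall fun _ => hM _)).congr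
    (.of_forall fun p => ?_)
  simp only [Complex.coe_algebraMap, Complex.real_smul, mul_assoc]

theorem integral_smul_mul_sub (h κ : ℝ → ℂ) (ψ : ℝ → ℝ) (s : ℝ) :
    ∫ t, ψ t • (h s * κ (t - s)) = h s * ∫ t, ψ (t + s) • κ t := by
  rw [← integral_sub_right_eq_self (fun t => ψ (t + s) • κ t) s, ← integral_const_mul]
  simp only [sub_add_cancel, mul_smul_comm]

theorem integrable_mul_integral_smul {h κ : ℝ → ℂ} {M : ℝ} {ψ : ℝ → ℝ} (hh : Integrable h)
    (hκ : Measurable κ) (hM : ∀ t, ‖κ t‖ ≤ M) (hψ : Integrable ψ) :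
    Integrable fun s => h s * ∫ t, ψ (t + s) • κ t := by
  simpa only [integral_smul_mul_sub] using
    (integrable_prod_smul_mul_sub hh hκ hM hψ).integral_prod_right

theorem integral_smul_convolution {h κ : ℝ → ℂ} {M : ℝ} {ψ : ℝ → ℝ} (hh : Integrable h)
    (hκ : Measurable κ) (hM : ∀ t, ‖κ t‖ ≤ M) (hψ : Integrable ψ) :
    ∫ t, ψ t • (h ⋆[mul ℂ ℂ] κ) t = ∫ s, h s * ∫ t, ψ (t + s) • κ t := by
  simp only [convolution_mul, ← integral_smul_mul_sub, ← integral_smul]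
  exact integral_integral_swap (integrable_prod_smul_mul_sub hh hκ hM hψ)

theorem HasJumpDeriv.convolution {κ κ' : ℝ → ℂ} {c : ℂ} {M M' : ℝ} (hκκ' : HasJumpDeriv κ κ' c)
    (hκ : Measurable κ) (hM : ∀ t, ‖κ t‖ ≤ M) (hκ' : Measurable κ') (hM' : ∀ t, ‖κ' t‖ ≤ M')
    {h : ℝ → ℂ} (hh : Integrable h) :
    HasWeakDeriv (h ⋆[mul ℂ ℂ] κ) (fun t => c * h t + (h ⋆[mul ℂ ℂ] κ') t) := by
  intro ψ hψ hc
  have continuous_deriv : Continuous (deriv ψ) := hψ.continuous_deriv (by simp)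
  have integrable_ψ : Integrable ψ := hψ.continuous.integrable_of_hasCompactSupport hc
  have integrable_smul {f : ℝ → ℂ} (hf : LocallyIntegrable f) : Integrable fun t => ψ t • f t :=
    hf.integrable_smul_left_of_hasCompactSupport hψ.continuous hc
  have integrable_h_smul : Integrable fun t => ψ t • (c * h t) :=
    integrable_smul (hh.const_mul c).locallyIntegrable
  have shifted (s : ℝ) : ∫ t, deriv ψ (t + s) • κ t = -(ψ s • c) - ∫ t, ψ (t + s) • κ' t := by
    simpa only [deriv_comp_add_const, zero_add] using hκκ' (fun t => ψ (t + s))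
      (hψ.comp (contDiff_id.add contDiff_const)) (hc.comp_homeomorph (Homeomorph.addRight s))
  calc ∫ t, deriv ψ t • (h ⋆[mul ℂ ℂ] κ) t
      = ∫ s, (-(ψ s • (c * h s)) - h s * ∫ t, ψ (t + s) • κ' t) := by
        rw [integral_smul_convolution hh hκ hM
          (continuous_deriv.integrable_of_hasCompactSupport hc.deriv)]
        refine integral_congr_ae (.of_forall fun s => ?_)
        simp only [shifted, mul_sub, mul_neg, mul_smul_comm, mul_comm c]
    _ = -∫ t, ψ t • (c * h t + (h ⋆[mul ℂ ℂ] κ') t) := by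
        rw [integral_sub integrable_h_smul.fun_neg
          (integrable_mul_integral_smul hh hκ' hM' integrable_ψ),
          integral_neg, ← integral_smul_convolution hh hκ' hM' integrable_ψ]
        simp only [smul_add]
        rw [integral_add integrable_h_smul
          (integrable_smul (locallyIntegrable_convolution hh hκ' hM')), neg_add']

/-- The kernel `t ↦ exp(iβ|t|)`. -/
def expKer (β : ℂ) (t : ℝ) : ℂ := Complex.exp (Complex.I * β * |t|)

/-- The kernel `t ↦ sgn(t) exp(iβ|t|)`, with `sgn(0) = -1`. -/
def sgnExpKer (β : ℂ) (t : ℝ) : ℂ := if 0 < t then expKer β t else -expKer β t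

theorem continuous_expKer (β : ℂ) : Continuous (expKer β) := by
  unfold expKer
  fun_prop

theorem measurable_sgnExpKer (β : ℂ) : Measurable (sgnExpKer β) :=
  .ite measurableSet_Ioi (continuous_expKer β).measurable (continuous_expKer β).measurable.neg

theorem norm_expKer (β : ℂ) (t : ℝ) : ‖expKer β t‖ = Real.exp (-(β.im * |t|)) := by
  rw [expKer, Complex.norm_exp]
  simp

theorem norm_expKer_le_one {β : ℂ} (hβ : 0 ≤ β.im) (t : ℝ) : ‖expKer β t‖ ≤ 1 := by
  rw [norm_expKer, Real.exp_le_one_iff, neg_nonpos]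
  positivity

theorem norm_sgnExpKer (β : ℂ) (t : ℝ) : ‖sgnExpKer β t‖ = ‖expKer β t‖ := by
  rw [sgnExpKer, apply_ite norm, norm_neg, ite_self]

theorem expKer_eq_ite (β : ℂ) :
    expKer β = fun t : ℝ => if 0 < t then Complex.exp (Complex.I * β * t)
      else Complex.exp (-(Complex.I * β) * t) := by
  funext t
  split_ifs with ht
  · rw [expKer, abs_of_pos ht]
  · rw [expKer, abs_of_nonpos (not_lt.1 ht), Complex.ofReal_neg, mul_neg, neg_mul]

theorem sgnExpKer_eq_ite (β : ℂ) :
    sgnExpKer β = fun t : ℝ => if 0 < t then Complex.exp (Complex.I * β * t)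
      else -Complex.exp (-(Complex.I * β) * t) := by
  funext t
  simp only [sgnExpKer, expKer_eq_ite]
  split_ifs <;> rfl

theorem hasJumpDeriv_expKer (β : ℂ) :
    HasJumpDeriv (expKer β) (fun t => Complex.I * β * sgnExpKer β t) 0 := by
  simpa [expKer_eq_ite, sgnExpKer_eq_ite, mul_ite] using
    hasJumpDeriv_ite (hasDerivAt_exp_mul (Complex.I * β)) (by fun_prop)
      (hasDerivAt_exp_mul (-(Complex.I * β))) (by fun_prop)

theorem hasJumpDeriv_sgnExpKer (β : ℂ) :
    HasJumpDeriv (sgnExpKer β) (fun t => Complex.I * β * expKer β t) 2 := by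
  simpa [expKer_eq_ite, sgnExpKer_eq_ite, mul_ite, one_add_one_eq_two] using
    hasJumpDeriv_ite (hasDerivAt_exp_mul (Complex.I * β)) (by fun_prop)
      (fun t => (hasDerivAt_exp_mul (-(Complex.I * β)) t).neg) (by fun_prop)

/-! ### Bounds for the wave numbers and the kernels -/

/-- The weight `1 + |j|`, comparable to `|β_j|` when no `β_j` vanishes. -/
def wt (j : ℤ) : ℝ := 1 + |(j : ℝ)|

theorem one_le_wt (j : ℤ) : 1 ≤ wt j := le_add_of_nonneg_right (abs_nonneg _)

theorem wt_pos (j : ℤ) : 0 < wt j := zero_lt_one.trans_le (one_le_wt j)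

theorem norm_wt (j : ℤ) : ‖(wt j : ℂ)‖ = wt j := by
  rw [Complex.norm_real, Real.norm_of_nonneg (wt_pos j).le]

theorem betaJ_im_nonneg (k α : ℝ) (j : ℤ) : 0 ≤ (betaJ k α j).im := by
  unfold betaJ
  split_ifs <;> simp [Real.sqrt_nonneg]

theorem norm_betaJ (k α : ℝ) (j : ℤ) : ‖betaJ k α j‖ = √|k ^ 2 - alphaJ α j ^ 2| := by
  unfold betaJ
  split_ifs with h
  · rw [Complex.norm_real, Real.norm_of_nonneg (Real.sqrt_nonneg _), abs_of_nonneg (by linarith)]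
  · rw [norm_mul, Complex.norm_I, one_mul, Complex.norm_real,
      Real.norm_of_nonneg (Real.sqrt_nonneg _), abs_of_neg (by linarith), neg_sub]

theorem betaJ_ne_zero {k α : ℝ} {j : ℤ} (hres : k ^ 2 ≠ alphaJ α j ^ 2) : betaJ k α j ≠ 0 := by
  rw [← norm_pos_iff, norm_betaJ, Real.sqrt_pos, abs_pos]
  exact sub_ne_zero.2 hres

theorem abs_alphaJ_le (α : ℝ) (j : ℤ) : |alphaJ α j| ≤ (1 + |α|) * wt j := by
  have := abs_add_le (j : ℝ) α
  unfold alphaJ wt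
  nlinarith [abs_nonneg (j : ℝ), abs_nonneg α]

theorem norm_betaJ_le {k : ℝ} (hk : 0 < k) (α : ℝ) (j : ℤ) :
    ‖betaJ k α j‖ ≤ (k + 1 + |α|) * wt j := by
  have sqrt_le : √|k ^ 2 - alphaJ α j ^ 2| ≤ k + |alphaJ α j| := by
    rw [Real.sqrt_le_left (by positivity), abs_le]
    have := sq_abs (alphaJ α j)
    constructor <;> nlinarith [abs_nonneg (alphaJ α j)]
  rw [norm_betaJ]
  nlinarith [abs_alphaJ_le α j, one_le_wt j]

theorem wt_div_four_le_betaJ_im {k : ℝ} (hk : 0 < k) {α : ℝ} {j : ℤ}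
    (hj : 4 * (|α| + k + 1) ≤ |(j : ℝ)|) : wt j / 4 ≤ (betaJ k α j).im := by
  have abs_α_nonneg := abs_nonneg α
  have le_abs_alphaJ : 3 / 4 * |(j : ℝ)| ≤ |alphaJ α j| := by
    have := abs_sub_abs_le_abs_sub (j : ℝ) (-α)
    rw [abs_neg, sub_neg_eq_add] at this
    unfold alphaJ
    linarith
  have le_alphaJ_sq : 9 / 16 * |(j : ℝ)| ^ 2 ≤ alphaJ α j ^ 2 := by
    rw [← sq_abs (alphaJ α j)]
    nlinarith [abs_nonneg (j : ℝ)]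
  have k_sq_le : k ^ 2 ≤ 1 / 16 * |(j : ℝ)| ^ 2 := by nlinarith
  rw [betaJ, if_neg (by nlinarith)]
  simp only [Complex.mul_im, Complex.I_re, Complex.I_im, Complex.ofReal_re, Complex.ofReal_im,
    mul_zero, one_mul, zero_add]
  refine Real.le_sqrt_of_sq_le ?_
  unfold wt
  nlinarith

theorem eventually_cofinite_le_abs_intCast (N : ℝ) :
    ∀ᶠ j : ℤ in Filter.cofinite, N ≤ |(j : ℝ)| := by
  rw [← Filter.cocompact_eq_cofinite]
  filter_upwards [(tendsto_norm_cocompact_atTop (E := ℤ)).eventually_ge_atTop N] with j hj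
  rwa [← Int.norm_eq_abs]

theorem exists_norm_inv_betaJ_mul_wt_le {k : ℝ} (hk : 0 < k) (α : ℝ) :
    ∃ C, ∀ j, ‖(betaJ k α j)⁻¹‖ * wt j ≤ C := by
  have eventually_le : ∀ᶠ j : ℤ in Filter.cofinite, ‖(betaJ k α j)⁻¹‖ * wt j ≤ 4 := by
    filter_upwards [eventually_cofinite_le_abs_intCast (4 * (|α| + k + 1))] with j hj
    have le_im := wt_div_four_le_betaJ_im hk hj
    have im_le_norm := (le_abs_self _).trans (Complex.abs_im_le_norm (betaJ k α j))
    have := wt_pos j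
    rw [norm_inv, inv_mul_le_iff₀ (by linarith)]
    linarith
  obtain ⟨C, hC⟩ :=
    (Filter.isBoundedUnder_of_eventually_le eventually_le).bddAbove_range_of_cofinite
  exact ⟨C, fun j => hC ⟨j, rfl⟩⟩

theorem lintegral_exp_neg_mul_abs {b : ℝ} (hb : 0 < b) :
    ∫⁻ t : ℝ, ENNReal.ofReal (Real.exp (-(b * |t|))) = ENNReal.ofReal (2 / b) := by
  have integral_eq : ∫ t : ℝ, Real.exp (-(b * |t|)) = 2 / b := by
    rw [integral_comp_abs (f := fun t => Real.exp (-(b * t)))]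
    simp only [← neg_mul]
    rw [integral_exp_mul_Ioi (neg_lt_zero.2 hb), mul_zero, Real.exp_zero, neg_div_neg_eq,
      mul_one_div]
  rw [← integral_eq, ofReal_integral_eq_lintegral_ofReal]
  · exact Integrable.of_integral_ne_zero (by rw [integral_eq]; positivity)
  · exact .of_forall fun t => (Real.exp_pos _).le

theorem lintegral_enorm_expKer {β : ℂ} (hβ : 0 < β.im) :
    ∫⁻ t, ‖expKer β t‖ₑ = ENNReal.ofReal (2 / β.im) := by
  simp only [← ofReal_norm, norm_expKer, lintegral_exp_neg_mul_abs hβ]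

theorem expKer_sub_comm (β : ℂ) (s t : ℝ) : expKer β (t - s) = expKer β (s - t) := by
  rw [expKer, expKer, abs_sub_comm]

theorem exists_lintegral_expKer_le {k : ℝ} (hk : 0 < k) (α : ℝ) {τ : Measure ℝ}
    [IsFiniteMeasure τ] (hτ : τ ≤ volume) : ∃ C, ∀ j s,
      ∫⁻ t, ‖expKer (betaJ k α j) (t - s)‖ₑ ∂τ ≤ ENNReal.ofReal (C / wt j) := by
  set N := 4 * (|α| + k + 1)
  refine ⟨max 8 (τ.real univ * (1 + N)), fun j s => ?_⟩
  have wt_j_pos := wt_pos j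
  by_cases hj : N ≤ |(j : ℝ)|
  · have le_im := wt_div_four_le_betaJ_im hk hj
    have im_pos : 0 < (betaJ k α j).im := by linarith
    calc ∫⁻ t, ‖expKer (betaJ k α j) (t - s)‖ₑ ∂τ
        ≤ ∫⁻ t, ‖expKer (betaJ k α j) (t - s)‖ₑ := lintegral_mono' hτ le_rfl
      _ = ENNReal.ofReal (2 / (betaJ k α j).im) := by
          rw [lintegral_sub_right_eq_self (μ := volume) fun t => ‖expKer (betaJ k α j) t‖ₑ,
            lintegral_enorm_expKer im_pos]
      _ ≤ ENNReal.ofReal (max 8 (τ.real univ * (1 + N)) / wt j) := by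
          refine ENNReal.ofReal_le_ofReal ?_
          rw [div_le_div_iff₀ im_pos wt_j_pos]
          nlinarith [le_max_left 8 (τ.real univ * (1 + N))]
  · calc ∫⁻ t, ‖expKer (betaJ k α j) (t - s)‖ₑ ∂τ ≤ ∫⁻ _, 1 ∂τ := by
          refine lintegral_mono fun t => ?_
          rw [← ofReal_norm]
          exact ENNReal.ofReal_le_one.2 (norm_expKer_le_one (betaJ_im_nonneg k α j) (t - s))
      _ = ENNReal.ofReal (τ.real univ) := by rw [lintegral_one, ofReal_measureReal]
      _ ≤ ENNReal.ofReal (max 8 (τ.real univ * (1 + N)) / wt j) := by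
          refine ENNReal.ofReal_le_ofReal ?_
          rw [le_div_iff₀ wt_j_pos]
          refine le_trans ?_ (le_max_right _ _)
          refine mul_le_mul_of_nonneg_left ?_ measureReal_nonneg
          unfold wt
          linarith

/-! ### Square integrable families -/

theorem sq_lintegral_mul_le {X : Type*} [MeasurableSpace X] {σ : Measure X} {f g : X → ℝ≥0∞}
    (hf : AEMeasurable f σ) (hg : AEMeasurable g σ) :
    (∫⁻ x, f x * g x ∂σ) ^ 2 ≤ (∫⁻ x, f x ∂σ) * ∫⁻ x, f x * g x ^ 2 ∂σ := by
  have sqrt_sq (a : ℝ≥0∞) : (a ^ (1 / 2 : ℝ)) ^ (2 : ℝ) = a := by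
    rw [← ENNReal.rpow_mul, one_div_mul_cancel two_ne_zero, ENNReal.rpow_one]
  have sqrt_mul_sqrt (a b : ℝ≥0∞) : a ^ (1 / 2 : ℝ) * (a ^ (1 / 2 : ℝ) * b) = a * b := by
    rw [← mul_assoc, ← sq, ← ENNReal.rpow_two, sqrt_sq]
  have holder := ENNReal.lintegral_mul_le_Lp_mul_Lq σ Real.HolderConjugate.two_two
    (f := fun x => f x ^ (1 / 2 : ℝ)) (g := fun x => f x ^ (1 / 2 : ℝ) * g x)
    (hf.pow_const _) ((hf.pow_const _).mul hg)
  simp only [Pi.mul_apply, sqrt_mul_sqrt, ENNReal.mul_rpow_of_nonneg _ _ zero_le_two, sqrt_sq,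
    ENNReal.rpow_two] at holder
  calc (∫⁻ x, f x * g x ∂σ) ^ 2
      ≤ ((∫⁻ x, f x ∂σ) ^ (1 / 2 : ℝ) * (∫⁻ x, f x * g x ^ 2 ∂σ) ^ (1 / 2 : ℝ)) ^ 2 := by gcongr
    _ = (∫⁻ x, f x ∂σ) * ∫⁻ x, f x * g x ^ 2 ∂σ := by
        rw [mul_pow, ← ENNReal.rpow_two, ← ENNReal.rpow_two, sqrt_sq, sqrt_sq]

theorem enorm_convolution_sq_le {κ h : ℝ → ℂ} (hκ : Measurable κ) (hh : AEStronglyMeasurable h)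
    {S : Set ℝ} (hS : ∀ s ∉ S, h s = 0) {b : ℝ≥0∞} (hb : ∀ t, ∫⁻ s in S, ‖κ (t - s)‖ₑ ≤ b)
    (t : ℝ) : ‖(h ⋆[mul ℂ ℂ] κ) t‖ₑ ^ 2 ≤ b * ∫⁻ s, ‖κ (t - s)‖ₑ * ‖h s‖ₑ ^ 2 := by
  have enorm_le : ‖(h ⋆[mul ℂ ℂ] κ) t‖ₑ ≤ ∫⁻ s in S, ‖κ (t - s)‖ₑ * ‖h s‖ₑ := by
    rw [convolution_mul, ← setIntegral_eq_integral_of_forall_compl_eq_zero (s := S) fun s hs => by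
      rw [hS s hs, zero_mul]]
    refine (enorm_integral_le_lintegral_enorm _).trans_eq ?_
    simp only [enorm_mul, mul_comm]
  calc ‖(h ⋆[mul ℂ ℂ] κ) t‖ₑ ^ 2
      ≤ (∫⁻ s in S, ‖κ (t - s)‖ₑ * ‖h s‖ₑ) ^ 2 := by gcongr
    _ ≤ (∫⁻ s in S, ‖κ (t - s)‖ₑ) * ∫⁻ s in S, ‖κ (t - s)‖ₑ * ‖h s‖ₑ ^ 2 :=
        sq_lintegral_mul_le (hκ.comp (by fun_prop)).enorm.aemeasurable hh.enorm.restrict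
    _ ≤ b * ∫⁻ s, ‖κ (t - s)‖ₑ * ‖h s‖ₑ ^ 2 := mul_le_mul' (hb t) (setLIntegral_le_lintegral _ _)

theorem lintegral_convolution_sq_le {κ h : ℝ → ℂ} (hκ : Measurable κ)
    (hh : AEStronglyMeasurable h) {S : Set ℝ} (hS : ∀ s ∉ S, h s = 0) {μ : Measure ℝ} [SFinite μ]
    {b : ℝ≥0∞} (hb : ∀ t, ∫⁻ s in S, ‖κ (t - s)‖ₑ ≤ b)
    (hbμ : ∀ s, ∫⁻ t, ‖κ (t - s)‖ₑ ∂μ ≤ b) :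
    ∫⁻ t, ‖(h ⋆[mul ℂ ℂ] κ) t‖ₑ ^ 2 ∂μ ≤ b ^ 2 * ∫⁻ s, ‖h s‖ₑ ^ 2 := by
  have measurable_κ (s : ℝ) : Measurable fun t => ‖κ (t - s)‖ₑ := (hκ.comp (by fun_prop)).enorm
  have aemeasurable_prod : AEMeasurable (fun p : ℝ × ℝ => ‖κ (p.1 - p.2)‖ₑ * ‖h p.2‖ₑ ^ 2)
      (μ.prod volume) :=
    (hκ.comp (by fun_prop)).enorm.aemeasurable.mul (hh.comp_snd.enorm.pow_const 2)
  calc ∫⁻ t, ‖(h ⋆[mul ℂ ℂ] κ) t‖ₑ ^ 2 ∂μ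
      ≤ ∫⁻ t, (b * ∫⁻ s, ‖κ (t - s)‖ₑ * ‖h s‖ₑ ^ 2) ∂μ :=
        lintegral_mono fun t => enorm_convolution_sq_le hκ hh hS hb t
    _ = b * ∫⁻ s, (∫⁻ t, ‖κ (t - s)‖ₑ * ‖h s‖ₑ ^ 2 ∂μ) := by
        rw [lintegral_const_mul'' _ aemeasurable_prod.lintegral_prod_right',
          lintegral_lintegral_swap aemeasurable_prod]
    _ ≤ b * ∫⁻ s, b * ‖h s‖ₑ ^ 2 := by
        gcongr with s
        rw [lintegral_mul_const _ (measurable_κ s)]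
        exact mul_le_mul_left (hbμ s) _
    _ = b ^ 2 * ∫⁻ s, ‖h s‖ₑ ^ 2 := by
        rw [lintegral_const_mul'' _ (hh.enorm.pow_const 2), ← mul_assoc, ← sq]

/-- The family `u` belongs to `ℓ²(ℤ; L²(μ))`. -/
def IsL2Family (u : ℤ → ℝ → ℂ) (μ : Measure ℝ) : Prop :=
  MemLp (fun p : ℤ × ℝ => u p.1 p.2) 2 (Measure.count.prod μ)

theorem count_prod_eq_sum_map (μ : Measure ℝ) [SFinite μ] :
    (Measure.count : Measure ℤ).prod μ = Measure.sum fun j => μ.map (Prod.mk j) := by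
  rw [Measure.count, Measure.prod_sum_left]
  simp only [Measure.dirac_prod]

theorem aestronglyMeasurable_count_prod_iff {u : ℤ → ℝ → ℂ} {μ : Measure ℝ} [SFinite μ] :
    AEStronglyMeasurable (fun p : ℤ × ℝ => u p.1 p.2) (Measure.count.prod μ) ↔
      ∀ j, AEStronglyMeasurable (u j) μ := by
  rw [count_prod_eq_sum_map, aestronglyMeasurable_sum_measure_iff]
  exact forall_congr' fun j => (measurableEmbedding_prodMk_left j).aestronglyMeasurable_map_iff

theorem isL2Family_of_tsum_ne_top {u : ℤ → ℝ → ℂ} {μ : Measure ℝ} [SFinite μ]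
    (hu : ∀ j, AEStronglyMeasurable (u j) μ) (hs : ∑' j, ∫⁻ t, ‖u j t‖ₑ ^ 2 ∂μ ≠ ⊤) :
    IsL2Family u μ := by
  have measurable_u := aestronglyMeasurable_count_prod_iff.2 hu
  refine ⟨measurable_u, ?_⟩
  rw [eLpNorm_lt_top_iff_lintegral_rpow_enorm_lt_top (by simp) (by simp)]
  simp only [ENNReal.toReal_ofNat, ENNReal.rpow_two]
  rw [lintegral_prod _ (measurable_u.enorm.pow_const 2), lintegral_count]
  exact hs.lt_top

namespace IsL2Family

variable {u v : ℤ → ℝ → ℂ} {μ : Measure ℝ}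

theorem add (hu : IsL2Family u μ) (hv : IsL2Family v μ) : IsL2Family (fun j t => u j t + v j t) μ :=
  MemLp.add hu hv

theorem mono_measure {ν : Measure ℝ} [SFinite ν] (hu : IsL2Family u ν)
    (hμν : μ ≤ ν) : IsL2Family u μ :=
  MemLp.mono_measure (Measure.prod_mono le_rfl hμν) hu

variable [SFinite μ]

theorem of_norm_le (hu : IsL2Family u μ) {C : ℝ} (hv : ∀ j, AEStronglyMeasurable (v j) μ)
    (hvu : ∀ j t, ‖v j t‖ ≤ C * ‖u j t‖) : IsL2Family v μ :=
  MemLp.of_le_mul hu (aestronglyMeasurable_count_prod_iff.2 hv) (.of_forall fun p => hvu p.1 p.2)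

theorem memLp (hu : IsL2Family u μ) (j : ℤ) : MemLp (u j) 2 μ := by
  rw [IsL2Family, count_prod_eq_sum_map] at hu
  exact (measurableEmbedding_prodMk_left j).memLp_map_measure_iff.1
    (hu.mono_measure (Measure.le_sum (fun j => μ.map (Prod.mk j)) j))

theorem tsum_ne_top (hu : IsL2Family u μ) : ∑' j, ∫⁻ t, ‖u j t‖ₑ ^ 2 ∂μ ≠ ⊤ := by
  have := hu.2
  rw [eLpNorm_lt_top_iff_lintegral_rpow_enorm_lt_top (by simp) (by simp)] at this
  simp only [ENNReal.toReal_ofNat, ENNReal.rpow_two] at this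
  rw [lintegral_prod _ (hu.1.enorm.pow_const 2), lintegral_count] at this
  exact this.ne

theorem summable (hu : IsL2Family u μ) : Summable fun j => ∫ t, ‖u j t‖ ^ 2 ∂μ :=
  summable_norm_iff.1 <| integrable_count_iff.1
    ((memLp_two_iff_integrable_sq_norm hu.1).1 hu).integral_prod_left

end IsL2Family

theorem integrable_of_memLp_two {h : ℝ → ℂ} (hh : MemLp h 2) {S : Set ℝ} (hS : volume S ≠ ⊤)
    (h0 : ∀ s ∉ S, h s = 0) : Integrable h := by
  have : IsFiniteMeasure (volume.restrict S) := isFiniteMeasure_restrict.2 hS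
  exact (integrableOn_iff_integrable_of_support_subset (Function.support_subset_iff'.2 h0)).1
    ((hh.restrict S).integrable one_le_two)

theorem IsL2Family.convolution {k : ℝ} (hk : 0 < k) (α : ℝ) {h : ℤ → ℝ → ℂ}
    (hh : IsL2Family h volume) {S : Set ℝ} (hS : volume S ≠ ⊤) (h0 : ∀ j, ∀ s ∉ S, h j s = 0)
    {K : ℤ → ℝ → ℂ} (hK : ∀ j, Measurable (K j))
    (norm_K : ∀ j t, ‖K j t‖ = ‖expKer (betaJ k α j) t‖) :
    IsL2Family (fun j t => wt j * (h j ⋆[mul ℂ ℂ] K j) t) lineMeas := by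
  have : IsFiniteMeasure (volume.restrict S) := isFiniteMeasure_restrict.2 hS
  obtain ⟨C₁, hC₁⟩ := exists_lintegral_expKer_le hk α lineMeas_le_volume
  obtain ⟨C₂, hC₂⟩ := exists_lintegral_expKer_le hk α (Measure.restrict_le_self (s := S))
  set b : ℤ → ℝ≥0∞ := fun j => ENNReal.ofReal (max C₁ C₂ / wt j)
  have enorm_K (j : ℤ) (t : ℝ) : ‖K j t‖ₑ = ‖expKer (betaJ k α j) t‖ₑ := by
    rw [← ofReal_norm, norm_K, ofReal_norm]
  have le_b {C : ℝ} (hC : C ≤ max C₁ C₂) (j : ℤ) : ENNReal.ofReal (C / wt j) ≤ b j :=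
    ENNReal.ofReal_le_ofReal (div_le_div_of_nonneg_right hC (wt_pos j).le)
  have schur (j : ℤ) : ∫⁻ t, ‖(h j ⋆[mul ℂ ℂ] K j) t‖ₑ ^ 2 ∂lineMeas ≤
      b j ^ 2 * ∫⁻ s, ‖h j s‖ₑ ^ 2 := by
    refine lintegral_convolution_sq_le (hK j) (hh.memLp j).1 (h0 j) (fun t => ?_) fun s => ?_
    · simp only [enorm_K, expKer_sub_comm _ _ t]
      exact (hC₂ j t).trans (le_b (le_max_right _ _) j)
    · simp only [enorm_K]
      exact (hC₁ j s).trans (le_b (le_max_left _ _) j)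
  have wt_mul_b (j : ℤ) : ‖(wt j : ℂ)‖ₑ * b j = ENNReal.ofReal (max C₁ C₂) := by
    rw [← ofReal_norm, norm_wt, ← ENNReal.ofReal_mul (wt_pos j).le,
      mul_div_cancel₀ _ (wt_pos j).ne']
  refine isL2Family_of_tsum_ne_top (fun j => ?_) ?_
  · exact (aestronglyMeasurable_convolution
      (integrable_of_memLp_two (hh.memLp j) hS (h0 j)) (hK j)).mono_measure
      lineMeas_le_volume |>.const_mul _
  refine ne_top_of_le_ne_top (b := ENNReal.ofReal (max C₁ C₂) ^ 2 * ∑' j, ∫⁻ s, ‖h j s‖ₑ ^ 2)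
    (ENNReal.mul_ne_top (by finiteness) hh.tsum_ne_top) ?_
  rw [← ENNReal.tsum_mul_left]
  refine ENNReal.tsum_le_tsum fun j => ?_
  simp only [enorm_mul, mul_pow]
  rw [lintegral_const_mul' _ _ (by finiteness), ← wt_mul_b j, mul_pow, mul_assoc]
  exact mul_le_mul_right (schur j) _

/-! ### Quasi-periodic Fourier coefficients -/

theorem neg_pi_lt_pi : -π < π := neg_lt_self Real.pi_pos

theorem integral_exp_mul_eq_fourierCoeffOn {f : ℝ → ℂ} (hf : ∀ y ∉ Ioo (-π) π, f y = 0) (j : ℤ) :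
    ∫ y : ℝ, Complex.exp (-(Complex.I * j * y)) * f y =
      (2 * π : ℝ) * fourierCoeffOn neg_pi_lt_pi f j := by
  have mul_inv_eq_one : ((2 * π : ℝ) : ℂ) * ((1 / (π - -π) : ℝ) : ℂ) = 1 := by
    rw [sub_neg_eq_add, ← two_mul, ← Complex.ofReal_mul, mul_one_div_cancel Real.two_pi_pos.ne',
      Complex.ofReal_one]
  rw [fourierCoeffOn_eq_integral, Complex.real_smul, ← mul_assoc, mul_inv_eq_one, one_mul,
    intervalIntegral.integral_of_le neg_pi_lt_pi.le,
    ← setIntegral_eq_integral_of_forall_compl_eq_zero (s := Ioc (-π) π) fun y hy => by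
      rw [hf y fun h => hy (Ioo_subset_Ioc_self h), mul_zero]]
  congr 1
  funext y
  have : (π : ℂ) ≠ 0 := Complex.ofReal_ne_zero.2 Real.pi_ne_zero
  rw [fourier_coe_apply, smul_eq_mul]
  congr 2
  push_cast
  field_simp
  ring

theorem tsum_enorm_integral_exp_mul_sq_le {f : ℝ → ℂ} (hf : MemLp f 2)
    (h0 : ∀ y ∉ Ioo (-π) π, f y = 0) :
    ∑' j : ℤ, ‖∫ y : ℝ, Complex.exp (-(Complex.I * j * y)) * f y‖ₑ ^ 2 ≤
      ENNReal.ofReal (2 * π) * ∫⁻ y, ‖f y‖ₑ ^ 2 := by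
  have parseval := (hasSum_sq_fourierCoeffOn neg_pi_lt_pi (hf.restrict _)).mul_left ((2 * π) ^ 2)
  have coeff_sq_eq (j : ℤ) : ‖∫ y : ℝ, Complex.exp (-(Complex.I * j * y)) * f y‖ₑ ^ 2 =
      ENNReal.ofReal ((2 * π) ^ 2 * ‖fourierCoeffOn neg_pi_lt_pi f j‖ ^ 2) := by
    rw [integral_exp_mul_eq_fourierCoeffOn h0, ← ofReal_norm, ← ENNReal.ofReal_pow (norm_nonneg _),
      norm_mul, mul_pow, Complex.norm_real, Real.norm_of_nonneg Real.two_pi_pos.le]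
  have energy_eq : (2 * π) ^ 2 * ((π - -π)⁻¹ • ∫ y in -π..π, ‖f y‖ ^ 2) =
      2 * π * ∫ y in Ioc (-π) π, ‖f y‖ ^ 2 := by
    rw [intervalIntegral.integral_of_le neg_pi_lt_pi.le, smul_eq_mul]
    field_simp
    ring
  simp only [coeff_sq_eq]
  rw [← ENNReal.ofReal_tsum_of_nonneg (fun j => by positivity) parseval.summable,
    parseval.tsum_eq, energy_eq, ENNReal.ofReal_mul Real.two_pi_pos.le,
    ofReal_integral_eq_lintegral_ofReal ((memLp_two_iff_integrable_sq_norm hf.1.restrict).1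
      (hf.restrict _)) (.of_forall fun y => by positivity)]
  simp only [ENNReal.ofReal_pow (norm_nonneg _), ofReal_norm]
  exact mul_le_mul_right (setLIntegral_le_lintegral _ _) _

/-- The open box `(-π, π) × (-ρ, ρ)`. -/
def box (ρ : ℝ) : Set (ℝ × ℝ) := Ioo (-π) π ×ˢ Ioo (-ρ) ρ

theorem volume_box_lt_top (ρ : ℝ) : volume (box ρ) < ⊤ := by
  rw [box, Measure.volume_eq_prod, Measure.prod_prod]
  exact ENNReal.mul_lt_top measure_Ioo_lt_top measure_Ioo_lt_top

/-- A measurable square integrable function on the plane that vanishes outside `box ρ`, the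
density of a volume potential. -/
structure IsDensity (ρ : ℝ) (γ : ℝ × ℝ → ℂ) : Prop where
  measurable : Measurable γ
  memLp : MemLp γ 2
  eq_zero : ∀ x ∉ box ρ, γ x = 0

/-- The Fourier coefficient `∫ exp(-iα_j y) γ(y, s) dy` of `γ` in the periodic variable. -/
def fourierCoef (α : ℝ) (γ : ℝ × ℝ → ℂ) (j : ℤ) (s : ℝ) : ℂ :=
  ∫ y : ℝ, Complex.exp (-(Complex.I * alphaJ α j * y)) * γ (y, s)

theorem norm_exp_neg_I_mul_mul (a x : ℝ) : ‖Complex.exp (-(Complex.I * a * x))‖ = 1 := by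
  rw [Complex.exp_neg, norm_inv, norm_exp_I_mul_mul, inv_one]

namespace IsDensity

variable {ρ : ℝ} {γ : ℝ × ℝ → ℂ}

theorem integrable (h : IsDensity ρ γ) : Integrable γ := by
  have : IsFiniteMeasure ((volume : Measure (ℝ × ℝ)).restrict (box ρ)) :=
    isFiniteMeasure_restrict.2 (volume_box_lt_top ρ).ne
  exact (integrableOn_iff_integrable_of_support_subset
    (Function.support_subset_iff'.2 h.eq_zero)).1 ((h.memLp.restrict _).integrable one_le_two)

theorem lintegral_sq_ne_top (h : IsDensity ρ γ) : ∫⁻ x, ‖γ x‖ₑ ^ 2 ≠ ⊤ := by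
  have := h.memLp.2
  rw [eLpNorm_lt_top_iff_lintegral_rpow_enorm_lt_top (by simp) (by simp)] at this
  simpa only [ENNReal.toReal_ofNat, ENNReal.rpow_two] using this.ne

theorem integrable_fourierCoef (h : IsDensity ρ γ) (α : ℝ) (j : ℤ) :
    Integrable (fourierCoef α γ j) := by
  have integrable_exp_mul : Integrable (fun p : ℝ × ℝ =>
      Complex.exp (-(Complex.I * alphaJ α j * p.1)) * γ p) (volume.prod volume) :=
    h.integrable.bdd_mul (c := 1) (by fun_prop)
      (.of_forall fun _ => (norm_exp_neg_I_mul_mul _ _).le)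
  exact integrable_exp_mul.integral_prod_right

theorem fourierCoef_eq_zero (h : IsDensity ρ γ) (α : ℝ) (j : ℤ) {s : ℝ} (hs : s ∉ Ioo (-ρ) ρ) :
    fourierCoef α γ j s = 0 := by
  have γ_eq_zero (y : ℝ) : γ (y, s) = 0 := h.eq_zero _ fun hy => hs hy.2
  simp only [fourierCoef, γ_eq_zero, mul_zero, integral_zero]

theorem tsum_enorm_fourierCoef_sq_le (h : IsDensity ρ γ) (α s : ℝ) :
    ∑' j, ‖fourierCoef α γ j s‖ₑ ^ 2 ≤ ENNReal.ofReal (2 * π) * ∫⁻ y, ‖γ (y, s)‖ₑ ^ 2 := by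
  by_cases hfin : ∫⁻ y, ‖γ (y, s)‖ₑ ^ 2 = ⊤
  · rw [hfin, ENNReal.mul_top (by simpa using Real.pi_pos)]
    exact le_top
  set f : ℝ → ℂ := fun y => Complex.exp (-(Complex.I * α * y)) * γ (y, s) with hf
  have measurable_f : Measurable f :=
    Measurable.mul (by fun_prop) (h.measurable.comp (by fun_prop))
  have enorm_f (y : ℝ) : ‖f y‖ₑ = ‖γ (y, s)‖ₑ := by
    rw [hf, ← ofReal_norm, norm_mul, norm_exp_neg_I_mul_mul, one_mul, ofReal_norm]
  have memLp_f : MemLp f 2 := by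
    refine ⟨measurable_f.aestronglyMeasurable, ?_⟩
    rw [eLpNorm_lt_top_iff_lintegral_rpow_enorm_lt_top (by simp) (by simp)]
    simpa only [enorm_f, ENNReal.toReal_ofNat, ENNReal.rpow_two] using lt_top_iff_ne_top.2 hfin
  have coef_eq (j : ℤ) :
      fourierCoef α γ j s = ∫ y : ℝ, Complex.exp (-(Complex.I * j * y)) * f y := by
    unfold fourierCoef alphaJ
    congr 1
    funext y
    rw [hf, ← mul_assoc, ← Complex.exp_add]
    congr 2
    push_cast
    ring
  simp only [coef_eq, ← enorm_f]
  exact tsum_enorm_integral_exp_mul_sq_le memLp_f fun y hy =>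
    mul_eq_zero_of_right _ (h.eq_zero _ fun hb => hy hb.1)

theorem isL2Family_fourierCoef (h : IsDensity ρ γ) (α : ℝ) :
    IsL2Family (fourierCoef α γ) volume := by
  have measurable_coef (j : ℤ) := (h.integrable_fourierCoef α j).1
  refine isL2Family_of_tsum_ne_top measurable_coef ?_
  rw [← lintegral_tsum fun j => (measurable_coef j).enorm.pow_const 2]
  refine ne_top_of_le_ne_top ?_ (lintegral_mono (h.tsum_enorm_fourierCoef_sq_le α))
  rw [lintegral_const_mul' _ _ ENNReal.ofReal_ne_top,
    ← lintegral_prod_symm' _ (h.measurable.enorm.pow_const 2), ← Measure.volume_eq_prod]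
  exact ENNReal.mul_ne_top ENNReal.ofReal_ne_top h.lintegral_sq_ne_top

theorem integral_mode_sub_mul (h : IsDensity ρ γ) (α : ℝ) (j : ℤ) {κ : ℝ → ℂ} (hκ : Measurable κ)
    {M : ℝ} (hM : ∀ t, ‖κ t‖ ≤ M) (x : ℝ × ℝ) :
    ∫ y, mode (alphaJ α j) κ (x - y) * γ y =
      mode (alphaJ α j) (fourierCoef α γ j ⋆[mul ℂ ℂ] κ) x := by
  have integrable_mul : Integrable (fun y : ℝ × ℝ => mode (alphaJ α j) κ (x - y) * γ y)
      (volume.prod volume) := by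
    refine h.integrable.bdd_mul (c := M) ?_ (.of_forall fun y => ?_)
    · exact (Measurable.mul (by fun_prop) (hκ.comp (by fun_prop))).aestronglyMeasurable
    · exact (norm_mode _ _ _).trans_le (hM _)
  have exp_sub (y : ℝ) : Complex.exp (Complex.I * alphaJ α j * ((x.1 - y : ℝ) : ℂ)) =
      Complex.exp (Complex.I * alphaJ α j * x.1) *
        Complex.exp (-(Complex.I * alphaJ α j * y)) := by
    rw [← Complex.exp_add]
    push_cast
    ring_nf
  rw [Measure.volume_eq_prod, integral_prod_symm _ integrable_mul, mode, convolution_mul,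
    ← integral_const_mul]
  congr 1
  funext s
  rw [fourierCoef, ← integral_mul_const, ← integral_const_mul]
  congr 1
  funext y
  rw [mode, Prod.fst_sub, Prod.snd_sub, exp_sub]
  ring

end IsDensity

/-! ### The Fourier series of the Green's function -/

theorem integrable_tsum {X ι E : Type*} [MeasurableSpace X] [Countable ι]
    [NormedAddCommGroup E] [CompleteSpace E] {μ : Measure X} {F : ι → X → E}
    (hF : ∀ i, AEStronglyMeasurable (F i) μ) (hs : ∑' i, ∫⁻ x, ‖F i x‖ₑ ∂μ ≠ ⊤) :
    (∀ᵐ x ∂μ, Summable fun i => ‖F i x‖) ∧ Integrable (fun x => ∑' i, F i x) μ := by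
  have lintegral_tsum_ne_top : ∫⁻ x, ∑' i, ‖F i x‖ₑ ∂μ ≠ ⊤ := by
    rwa [lintegral_tsum fun i => (hF i).enorm]
  have ae_summable : ∀ᵐ x ∂μ, Summable fun i => ‖F i x‖ := by
    filter_upwards [ae_lt_top' (AEMeasurable.tsum fun i => (hF i).enorm) lintegral_tsum_ne_top]
      with x hx
    simpa only [toReal_enorm] using ENNReal.summable_toReal hx.ne
  refine ⟨ae_summable, ?_, ?_⟩
  · exact aestronglyMeasurable_of_tendsto_ae (Filter.atTop : Filter (Finset ι))
      (fun s => Finset.aestronglyMeasurable_fun_sum s fun i _ => hF i)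
      (ae_summable.mono fun x hx => hx.of_norm.hasSum)
  · exact (lintegral_mono fun x => enorm_tsum_le_tsum_enorm).trans_lt lintegral_tsum_ne_top.lt_top

theorem hasSum_integral_of_tsum_lintegral_ne_top {X ι E : Type*} [MeasurableSpace X] [Countable ι]
    [NormedAddCommGroup E] [NormedSpace ℝ E] {μ : Measure X} {F : ι → X → E}
    (hF : ∀ i, AEStronglyMeasurable (F i) μ) (hs : ∑' i, ∫⁻ x, ‖F i x‖ₑ ∂μ ≠ ⊤) :
    HasSum (fun i => ∫ x, F i x ∂μ) (∫ x, ∑' i, F i x ∂μ) := by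
  refine hasSum_integral_of_summable_integral_norm
    (fun i => ⟨hF i, ENNReal.lt_top_of_tsum_ne_top hs i⟩) ?_
  simpa only [integral_norm_eq_lintegral_enorm (hF _)] using ENNReal.summable_toReal hs

theorem tsum_smul_smul_const {ι E : Type*} [NormedAddCommGroup E] [NormedSpace ℂ E] {a : ℝ}
    {f : ι → ℂ} {v : E} (hs : Summable fun i => ‖a • f i • v‖) :
    ∑' i, a • f i • v = a • (∑' i, f i) • v := by
  rcases eq_or_ne a 0 with rfl | ha
  · simp only [zero_smul, tsum_zero]
  rcases eq_or_ne v 0 with rfl | hv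
  · simp only [smul_zero, tsum_zero]
  simp only [norm_smul] at hs
  rw [summable_mul_left_iff (norm_ne_zero_iff.2 ha),
    summable_mul_right_iff (norm_ne_zero_iff.2 hv)] at hs
  rw [← hs.of_norm.tsum_smul_const, (hs.of_norm.smul_const v).tsum_const_smul]

theorem summable_inv_wt_sq : Summable fun j : ℤ => (wt j ^ 2)⁻¹ := by
  refine Summable.of_norm_bounded_eventually (Real.summable_one_div_int_pow.2 one_lt_two) ?_
  filter_upwards [Filter.eventually_cofinite_ne (0 : ℤ)] with j hj
  have : 0 < |(j : ℝ)| := abs_pos.2 (Int.cast_ne_zero.2 hj)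
  rw [Real.norm_of_nonneg (by positivity), ← sq_abs (j : ℝ), one_div]
  gcongr
  exact le_add_of_nonneg_left zero_le_one

/-- The kernel `i/(4π) β_j⁻¹ exp(iβ_j|t|)`, which is the `j`-th Fourier coefficient of the Green's
function as a function of `t = x₂`. -/
def greenKer (k α : ℝ) (j : ℤ) (t : ℝ) : ℂ :=
  Complex.I / (4 * π) * (betaJ k α j)⁻¹ * expKer (betaJ k α j) t

theorem green_eq_tsum (k α : ℝ) (z : ℝ × ℝ) :
    green k α z = ∑' j, mode (alphaJ α j) (greenKer k α j) z := by
  rw [green, ← tsum_mul_left]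
  refine tsum_congr fun j => ?_
  rw [mode, greenKer, expKer, Complex.exp_add]
  ring

theorem measurable_greenKer (k α : ℝ) (j : ℤ) : Measurable (greenKer k α j) :=
  (continuous_expKer _).measurable.const_mul _

theorem norm_greenKer_le (k α : ℝ) (j : ℤ) (t : ℝ) :
    ‖greenKer k α j t‖ ≤ ‖Complex.I / (4 * π) * (betaJ k α j)⁻¹‖ := by
  rw [greenKer, norm_mul]
  exact mul_le_of_le_one_right (norm_nonneg _) (norm_expKer_le_one (betaJ_im_nonneg k α j) t)

theorem measurable_mode {u : ℝ → ℂ} (hu : Measurable u) (a : ℝ) : Measurable (mode a u) :=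
  Measurable.mul (by fun_prop) (hu.comp measurable_snd)

theorem exists_lintegral_greenKer_le {k : ℝ} (hk : 0 < k) (α : ℝ) {τ : Measure ℝ}
    [IsFiniteMeasure τ] (hτ : τ ≤ volume) : ∃ C : ℝ≥0∞, C ≠ ⊤ ∧ ∀ j s,
      ∫⁻ t, ‖greenKer k α j (t - s)‖ₑ ∂τ ≤ C * ENNReal.ofReal (wt j ^ 2)⁻¹ := by
  obtain ⟨C₁, hC₁⟩ := exists_norm_inv_betaJ_mul_wt_le hk α
  obtain ⟨C₂, hC₂⟩ := exists_lintegral_expKer_le hk α hτ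
  set c : ℂ := Complex.I / (4 * π)
  refine ⟨‖c‖ₑ * ENNReal.ofReal C₁ * ENNReal.ofReal C₂, by finiteness, fun j s => ?_⟩
  have wt_inv_nonneg : 0 ≤ (wt j)⁻¹ := inv_nonneg.2 (wt_pos j).le
  have enorm_inv_betaJ_le :
      ‖(betaJ k α j)⁻¹‖ₑ ≤ ENNReal.ofReal C₁ * ENNReal.ofReal (wt j)⁻¹ := by
    rw [← ENNReal.ofReal_mul' wt_inv_nonneg, ← div_eq_mul_inv, ← ofReal_norm]
    exact ENNReal.ofReal_le_ofReal ((le_div_iff₀ (wt_pos j)).2 (hC₁ j))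
  calc ∫⁻ t, ‖greenKer k α j (t - s)‖ₑ ∂τ
      = ‖c‖ₑ * ‖(betaJ k α j)⁻¹‖ₑ * ∫⁻ t, ‖expKer (betaJ k α j) (t - s)‖ₑ ∂τ := by
        rw [← lintegral_const_mul' _ _ (by finiteness)]
        simp only [greenKer, enorm_mul, c]
    _ ≤ ‖c‖ₑ * (ENNReal.ofReal C₁ * ENNReal.ofReal (wt j)⁻¹) *
          (ENNReal.ofReal C₂ * ENNReal.ofReal (wt j)⁻¹) := by
        rw [← ENNReal.ofReal_mul' wt_inv_nonneg (p := C₂), ← div_eq_mul_inv]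
        gcongr
        exact hC₂ j s
    _ = ‖c‖ₑ * ENNReal.ofReal C₁ * ENNReal.ofReal C₂ * ENNReal.ofReal (wt j ^ 2)⁻¹ := by
        rw [← inv_pow, ENNReal.ofReal_pow wt_inv_nonneg]
        ring

/-! ### The Fourier series of the volume potential -/

/-- A bounded measurable function with compact support, used to localise integrals over the
plane. -/
structure IsCutoff (ψ : ℝ × ℝ → ℝ) : Prop where
  measurable : Measurable ψ
  exists_norm_le : ∃ M, ∀ x, ‖ψ x‖ ≤ M
  hasCompactSupport : HasCompactSupport ψ

theorem isCutoff_of_continuous {ψ : ℝ × ℝ → ℝ} (hψ : Continuous ψ) (hc : HasCompactSupport ψ) :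
    IsCutoff ψ :=
  ⟨hψ.measurable, hψ.bounded_above_of_compact_support hc, hc⟩

theorem isCutoff_indicator {K : Set (ℝ × ℝ)} (hK : IsCompact K) :
    IsCutoff (K.indicator fun _ => 1) where
  measurable := measurable_const.indicator hK.measurableSet
  exists_norm_le := ⟨1, fun x => (norm_indicator_le_norm_self _ x).trans norm_one.le⟩
  hasCompactSupport := HasCompactSupport.intro hK fun _ hx => indicator_of_notMem hx _

namespace IsCutoff

variable {ψ : ℝ × ℝ → ℝ}

theorem exists_enorm_le_indicator (h : IsCutoff ψ) :
    ∃ M R : ℝ, ∀ x, ‖ψ x‖ₑ ≤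
      (Ioo (-R) R ×ˢ Ioo (-R) R).indicator (fun _ => ENNReal.ofReal M) x := by
  obtain ⟨M, hM⟩ := h.exists_norm_le
  obtain ⟨R, hR⟩ := exists_subset_Ioo_prod_Ioo h.hasCompactSupport
  refine ⟨M, R, fun x => ?_⟩
  by_cases hx : x ∈ tsupport ψ
  · rw [indicator_of_mem (hR hx), ← ofReal_norm]
    exact ENNReal.ofReal_le_ofReal (hM x)
  · rw [image_eq_zero_of_notMem_tsupport hx, enorm_zero]
    exact zero_le

theorem exists_lintegral_mul_greenKer_le (h : IsCutoff ψ) {k : ℝ} (hk : 0 < k) (α : ℝ) :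
    ∃ C : ℝ≥0∞, C ≠ ⊤ ∧ ∀ j s, ∫⁻ x : ℝ × ℝ, ‖ψ x‖ₑ * ‖greenKer k α j (x.2 - s)‖ₑ ≤
      C * ENNReal.ofReal (wt j ^ 2)⁻¹ := by
  obtain ⟨M, R, hψ⟩ := h.exists_enorm_le_indicator
  set S := Ioo (-R) R
  obtain ⟨C, hC, hle⟩ := exists_lintegral_greenKer_le hk α
    (Measure.restrict_le_self (μ := (volume : Measure ℝ)) (s := S))
  have volume_S_ne_top : volume S ≠ ⊤ := measure_Ioo_lt_top.ne
  refine ⟨ENNReal.ofReal M * volume S * C, by finiteness, fun j s => ?_⟩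
  have measurable_ker : Measurable fun x : ℝ × ℝ => ‖greenKer k α j (x.2 - s)‖ₑ :=
    ((measurable_greenKer k α j).comp (by fun_prop)).enorm
  calc ∫⁻ x : ℝ × ℝ, ‖ψ x‖ₑ * ‖greenKer k α j (x.2 - s)‖ₑ
      ≤ ∫⁻ x : ℝ × ℝ, (S ×ˢ S).indicator
          (fun x => ENNReal.ofReal M * ‖greenKer k α j (x.2 - s)‖ₑ) x := by
        refine lintegral_mono fun x => ?_
        rw [indicator_mul_left]
        exact mul_le_mul_left (hψ x) _
    _ = ENNReal.ofReal M * (volume S * ∫⁻ t in S, ‖greenKer k α j (t - s)‖ₑ) := by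
        rw [lintegral_indicator (measurableSet_Ioo.prod measurableSet_Ioo),
          lintegral_const_mul' _ _ ENNReal.ofReal_ne_top, Measure.volume_eq_prod,
          ← Measure.prod_restrict,
          lintegral_prod _ measurable_ker.aemeasurable]
        simp only [lintegral_const, Measure.restrict_apply_univ, mul_comm]
        rfl
    _ ≤ ENNReal.ofReal M * volume S * C * ENNReal.ofReal (wt j ^ 2)⁻¹ := by
        rw [mul_assoc, mul_assoc]
        gcongr
        exact hle j s

variable {E : Type*} [NormedAddCommGroup E] [NormedSpace ℂ E] {G : ℝ × ℝ → E}

theorem aestronglyMeasurable_smul_mode_smul (h : IsCutoff ψ) (k α : ℝ) (hG : StronglyMeasurable G)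
    (j : ℤ) : AEStronglyMeasurable fun p : (ℝ × ℝ) × (ℝ × ℝ) =>
      ψ p.1 • mode (alphaJ α j) (greenKer k α j) (p.1 - p.2) • G p.2 := by
  have measurable_mode_sub : Measurable fun p : (ℝ × ℝ) × (ℝ × ℝ) =>
      mode (alphaJ α j) (greenKer k α j) (p.1 - p.2) :=
    (measurable_mode (measurable_greenKer k α j) _).comp (by fun_prop)
  exact ((h.measurable.comp measurable_fst).stronglyMeasurable.smul
    (measurable_mode_sub.stronglyMeasurable.smul
      (hG.comp_measurable measurable_snd))).aestronglyMeasurable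

theorem tsum_lintegral_smul_mode_smul_ne_top (h : IsCutoff ψ) {k : ℝ} (hk : 0 < k) (α : ℝ)
    (hG : StronglyMeasurable G) (hGi : Integrable G) :
    ∑' j, ∫⁻ p : (ℝ × ℝ) × (ℝ × ℝ),
      ‖ψ p.1 • mode (alphaJ α j) (greenKer k α j) (p.1 - p.2) • G p.2‖ₑ ≠ ⊤ := by
  obtain ⟨C, hC, hle⟩ := h.exists_lintegral_mul_greenKer_le hk α
  have lintegral_le (j : ℤ) : ∫⁻ p : (ℝ × ℝ) × (ℝ × ℝ),
      ‖ψ p.1 • mode (alphaJ α j) (greenKer k α j) (p.1 - p.2) • G p.2‖ₑ ≤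
        C * ENNReal.ofReal (wt j ^ 2)⁻¹ * ∫⁻ y, ‖G y‖ₑ := by
    rw [Measure.volume_eq_prod, lintegral_prod_symm _
      (h.aestronglyMeasurable_smul_mode_smul k α hG j).enorm,
      ← lintegral_const_mul' _ _ (by finiteness)]
    refine lintegral_mono fun y => ?_
    have measurable_ker : Measurable fun x : ℝ × ℝ => ‖ψ x‖ₑ * ‖greenKer k α j (x.2 - y.2)‖ₑ :=
      h.measurable.enorm.mul ((measurable_greenKer k α j).comp (by fun_prop)).enorm
    simp only [enorm_smul, ← ofReal_norm (mode _ _ _), norm_mode, Prod.snd_sub, ofReal_norm,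
      ← mul_assoc]
    rw [lintegral_mul_const _ measurable_ker]
    exact mul_le_mul_left (hle j y.2) _
  refine ne_top_of_le_ne_top ?_ (ENNReal.tsum_le_tsum lintegral_le)
  rw [ENNReal.tsum_mul_right, ENNReal.tsum_mul_left]
  exact ENNReal.mul_ne_top (ENNReal.mul_ne_top hC summable_inv_wt_sq.tsum_ofReal_ne_top)
    hGi.2.ne

variable [CompleteSpace E]

theorem ae_tsum_smul_mode_smul (h : IsCutoff ψ) {k : ℝ} (hk : 0 < k) (α : ℝ)
    (hG : StronglyMeasurable G) (hGi : Integrable G) : ∀ᵐ p : (ℝ × ℝ) × (ℝ × ℝ),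
      ∑' j, ψ p.1 • mode (alphaJ α j) (greenKer k α j) (p.1 - p.2) • G p.2 =
        ψ p.1 • green k α (p.1 - p.2) • G p.2 := by
  filter_upwards [(integrable_tsum (h.aestronglyMeasurable_smul_mode_smul k α hG)
    (h.tsum_lintegral_smul_mode_smul_ne_top hk α hG hGi)).1] with p hp
  rw [green_eq_tsum, tsum_smul_smul_const hp]

theorem integrable_smul_green_smul (h : IsCutoff ψ) {k : ℝ} (hk : 0 < k) (α : ℝ)
    (hG : StronglyMeasurable G) (hGi : Integrable G) :
    Integrable fun p : (ℝ × ℝ) × (ℝ × ℝ) => ψ p.1 • green k α (p.1 - p.2) • G p.2 :=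
  (integrable_tsum (h.aestronglyMeasurable_smul_mode_smul k α hG)
    (h.tsum_lintegral_smul_mode_smul_ne_top hk α hG hGi)).2.congr
    (h.ae_tsum_smul_mode_smul hk α hG hGi)

theorem hasSum_integral_smul_green_smul (h : IsCutoff ψ) {k : ℝ} (hk : 0 < k) (α : ℝ)
    (hG : StronglyMeasurable G) (hGi : Integrable G) :
    HasSum (fun j => ∫ p : (ℝ × ℝ) × (ℝ × ℝ),
        ψ p.1 • mode (alphaJ α j) (greenKer k α j) (p.1 - p.2) • G p.2)
      (∫ p : (ℝ × ℝ) × (ℝ × ℝ), ψ p.1 • green k α (p.1 - p.2) • G p.2) := by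
  rw [← integral_congr_ae (h.ae_tsum_smul_mode_smul hk α hG hGi)]
  exact hasSum_integral_of_tsum_lintegral_ne_top
    (h.aestronglyMeasurable_smul_mode_smul k α hG)
    (h.tsum_lintegral_smul_mode_smul_ne_top hk α hG hGi)

end IsCutoff

theorem IsDensity.indicator_apply {D : Set (ℝ × ℝ)} {ρ : ℝ} (hD : MeasurableSet D)
    (hDρ : D ⊆ box ρ) (g : L2v D) (i : Fin 2) : IsDensity ρ fun x => D.indicator g x i where
  measurable := (measurable_pi_apply i).comp ((PiLp.continuous_ofLp 2 _).measurable.comp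
    ((Lp.stronglyMeasurable g).measurable.indicator hD))
  memLp := (EuclideanSpace.proj (𝕜 := ℂ) i).comp_memLp'
    ((memLp_indicator_iff_restrict hD).2 (Lp.memLp g))
  eq_zero x hx := by rw [indicator_of_notMem fun h => hx (hDρ h), PiLp.zero_apply]

theorem integrable_indicator_L2v {D : Set (ℝ × ℝ)} {ρ : ℝ} (hD : MeasurableSet D)
    (hDρ : D ⊆ box ρ) (g : L2v D) : Integrable (D.indicator g) := by
  have : IsFiniteMeasure ((volume : Measure (ℝ × ℝ)).restrict D) :=
    isFiniteMeasure_restrict.2 ((measure_mono hDρ).trans_lt (volume_box_lt_top ρ)).ne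
  exact (integrable_indicator_iff hD).2 ((Lp.memLp g).integrable one_le_two)

theorem volPot_eq_integral_indicator {D : Set (ℝ × ℝ)} (hD : MeasurableSet D) (k α : ℝ)
    (g : L2v D) (x : ℝ × ℝ) :
    volPot k α D g x = ∫ y, green k α (x - y) • D.indicator g y := by
  rw [volPot, ← integral_indicator hD]
  simp only [indicator_smul]

namespace IsCutoff

variable {ψ : ℝ × ℝ → ℝ} {k ρ : ℝ} {D : Set (ℝ × ℝ)}

theorem integrable_smul_volPot (h : IsCutoff ψ) (hk : 0 < k) (α : ℝ) (hD : MeasurableSet D)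
    (hDρ : D ⊆ box ρ) (g : L2v D) : Integrable fun x => ψ x • volPot k α D g x := by
  have integrable_prod := h.integrable_smul_green_smul hk α
    ((Lp.stronglyMeasurable g).indicator hD) (integrable_indicator_L2v hD hDρ g)
  simpa only [integral_smul, ← volPot_eq_integral_indicator hD] using
    Integrable.integral_prod_left (μ := volume) (ν := volume) integrable_prod

theorem hasSum_integral_smul_volPot (h : IsCutoff ψ) (hk : 0 < k) (α : ℝ) (hD : MeasurableSet D)
    (hDρ : D ⊆ box ρ) (g : L2v D) (i : Fin 2) :
    HasSum (fun j => ∫ x, ψ x • mode (alphaJ α j)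
        (fourierCoef α (fun y => D.indicator g y i) j ⋆[mul ℂ ℂ] greenKer k α j) x)
      (∫ x, ψ x • volPot k α D g x i) := by
  have stronglyMeasurable_g := (Lp.stronglyMeasurable g).indicator hD
  have integrable_g := integrable_indicator_L2v hD hDρ g
  let P : C2 →L[ℂ] ℂ := EuclideanSpace.proj i
  have integral_green_eq : P (∫ p : (ℝ × ℝ) × (ℝ × ℝ),
      ψ p.1 • green k α (p.1 - p.2) • D.indicator g p.2) = ∫ x, ψ x • volPot k α D g x i := by
    have integrable_prod := h.integrable_smul_green_smul hk α stronglyMeasurable_g integrable_g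
    refine (congrArg P (integral_prod (μ := volume) (ν := volume) _ integrable_prod)).trans ?_
    simp only [integral_smul, ← volPot_eq_integral_indicator hD]
    exact (P.integral_comp_comm (h.integrable_smul_volPot hk α hD hDρ g)).symm
  have integral_mode_eq (j : ℤ) : P (∫ p : (ℝ × ℝ) × (ℝ × ℝ),
      ψ p.1 • mode (alphaJ α j) (greenKer k α j) (p.1 - p.2) • D.indicator g p.2) =
      ∫ x, ψ x • mode (alphaJ α j)
        (fourierCoef α (fun y => D.indicator g y i) j ⋆[mul ℂ ℂ] greenKer k α j) x := by
    have integrable_prod : Integrable fun p : (ℝ × ℝ) × (ℝ × ℝ) =>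
        ψ p.1 • mode (alphaJ α j) (greenKer k α j) (p.1 - p.2) • D.indicator g p.2 :=
      ⟨h.aestronglyMeasurable_smul_mode_smul k α stronglyMeasurable_g j,
        ENNReal.lt_top_of_tsum_ne_top
          (h.tsum_lintegral_smul_mode_smul_ne_top hk α stronglyMeasurable_g integrable_g) j⟩
    refine (P.integral_comp_comm integrable_prod).symm.trans ((integral_prod (μ := volume)
      (ν := volume) _ (P.integrable_comp integrable_prod)).trans ?_)
    simp only [← (IsDensity.indicator_apply hD hDρ g i).integral_mode_sub_mul α j
      (measurable_greenKer k α j) (norm_greenKer_le k α j), ← integral_smul]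
    rfl
  simpa only [← integral_green_eq, ← integral_mode_eq] using
    (h.hasSum_integral_smul_green_smul hk α stronglyMeasurable_g integrable_g).mapL P

end IsCutoff

theorem locallyIntegrable_volPot {D : Set (ℝ × ℝ)} {k ρ : ℝ} (hk : 0 < k) (α : ℝ)
    (hD : MeasurableSet D) (hDρ : D ⊆ box ρ) (g : L2v D) :
    LocallyIntegrable (volPot k α D g) := by
  rw [locallyIntegrable_iff]
  intro K hK
  rw [← integrable_indicator_iff hK.measurableSet]
  refine ((isCutoff_indicator hK).integrable_smul_volPot hk α hD hDρ g).congr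
    (.of_forall fun x => ?_)
  by_cases hx : x ∈ K <;> simp [hx]

/-! ### Quasi-periodic Fourier series in `H¹_loc` -/

theorem ae_comp_add_period {p : ℝ × ℝ → Prop} (h : ∀ᵐ x, p x) :
    ∀ᵐ x : ℝ × ℝ, p (x.1 + 2 * π, x.2) := by
  have measurePreserving_add : MeasurePreserving (fun x : ℝ × ℝ => x + (2 * π, 0)) :=
    measurePreserving_add_right volume (2 * π, 0)
  filter_upwards [measurePreserving_add.quasiMeasurePreserving.ae h] with x hx
  rwa [← add_zero x.2]

theorem isQuasiPeriodic_tsum_mode (α : ℝ) {u : ℤ → ℝ → ℂ} (hu : IsL2Family u lineMeas) :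
    IsQuasiPeriodic α (∑' j, (memLp_mode (hu.memLp j) (alphaJ α j)).toLp _ :
      Lp ℂ 2 planeMeas) := by
  set F := fun j => (memLp_mode (hu.memLp j) (alphaJ α j)).toLp _
  let e : ℕ ≃ ℤ := Equiv.intEquivNat.symm
  have hasSum_F : HasSum (F ∘ e) (∑' j, F j) :=
    e.hasSum_iff.2 (summable_mode α hu.memLp hu.summable).hasSum
  obtain ⟨ns, -, ae_tendsto⟩ :=
    (tendstoInMeasure_of_tendsto_Lp hasSum_F.tendsto_sum_nat).exists_seq_tendsto_ae
  have ae_sum_eq : ∀ᵐ x ∂planeMeas, ∀ n, (∑ i ∈ Finset.range n, F (e i) : Lp ℂ 2 planeMeas) x =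
      ∑ i ∈ Finset.range n, mode (alphaJ α (e i)) (u (e i)) x := by
    have ae_F_eq : ∀ᵐ x ∂planeMeas, ∀ i, F (e i) x = mode (alphaJ α (e i)) (u (e i)) x :=
      ae_all_iff.2 fun i => MemLp.coeFn_toLp _
    refine ae_all_iff.2 fun n => ?_
    filter_upwards [ae_F_eq, Lp.coeFn_finsetSum (Finset.range n) fun i => F (e i)] with x hF hsum
    rw [hsum, Finset.sum_apply]
    exact Finset.sum_congr rfl fun i _ => hF i
  have ae_volume := volume_absolutelyContinuous_planeMeas.ae_le (ae_tendsto.and ae_sum_eq)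
  filter_upwards [ae_volume, ae_comp_add_period ae_volume] with x hx hx_period
  refine tendsto_nhds_unique hx_period.1 ((hx.1.const_mul _).congr fun n => ?_)
  simp only [Function.comp_apply, hx.2, hx_period.2, mode_quasiPeriodic, Finset.mul_sum]

theorem hasSum_integral_smul_mode (α : ℝ) {u : ℤ → ℝ → ℂ} (hu : IsL2Family u lineMeas)
    {ψ : ℝ × ℝ → ℝ} (hψ : Continuous ψ) (hc : HasCompactSupport ψ) :
    HasSum (fun j => ∫ x, ψ x • mode (alphaJ α j) (u j) x)
      (∫ x, ψ x • (∑' j, (memLp_mode (hu.memLp j) (alphaJ α j)).toLp _ : Lp ℂ 2 planeMeas) x) := by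
  obtain ⟨T, hT⟩ := exists_clm_eq_integral_smul hψ hc
  have hasSum_T := (summable_mode α hu.memLp hu.summable).hasSum.mapL T
  rw [hT] at hasSum_T
  refine hasSum_T.congr_fun fun j => ?_
  rw [hT]
  refine integral_congr_ae ?_
  filter_upwards [volume_absolutelyContinuous_planeMeas.ae_le
    (memLp_mode (hu.memLp j) (alphaJ α j)).coeFn_toLp] with x hx
  rw [hx]

theorem exists_isH1Loc_of_isL2Family (α : ℝ) {u v : ℤ → ℝ → ℂ} (hu : IsL2Family u lineMeas)
    (hαu : IsL2Family (fun j t => Complex.I * alphaJ α j * u j t) lineMeas)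
    (hv : IsL2Family v lineMeas) (huv : ∀ j, HasWeakDeriv (u j) (v j)) :
    ∃ U P, IsH1Loc U P ∧ IsQuasiPeriodic α U ∧ ∀ ψ : ℝ × ℝ → ℝ, Continuous ψ →
      HasCompactSupport ψ →
      HasSum (fun j => ∫ x, ψ x • mode (alphaJ α j) (u j) x) (∫ x, ψ x • U x) := by
  set U : Lp ℂ 2 planeMeas := ∑' j, (memLp_mode (hu.memLp j) (alphaJ α j)).toLp _
  set P₁ : Lp ℂ 2 planeMeas := ∑' j, (memLp_mode (hαu.memLp j) (alphaJ α j)).toLp _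
  set P₂ : Lp ℂ 2 planeMeas := ∑' j, (memLp_mode (hv.memLp j) (alphaJ α j)).toLp _
  have memLp_P : MemLp (fun x => !₂[P₁ x, P₂ x]) 2 planeMeas := by
    refine MemLp.of_eval_piLp fun i => ?_
    fin_cases i
    · exact Lp.memLp P₁
    · exact Lp.memLp P₂
  refine ⟨U, fun x => !₂[P₁ x, P₂ x], ⟨isL2Loc_of_memLp_planeMeas (Lp.memLp U),
    isL2Loc_of_memLp_planeMeas memLp_P, fun φ hφ => ?_, fun φ hφ => ?_⟩,
    isQuasiPeriodic_tsum_mode α hu, fun ψ hψ hc => hasSum_integral_smul_mode α hu hψ hc⟩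
  · have hasSum_d1 := hasSum_integral_smul_mode α hu hφ.continuous_d1 hφ.compact_d1
    have hasSum_P₁ := (hasSum_integral_smul_mode α hαu hφ.smooth.continuous hφ.compact).neg
    refine hasSum_d1.unique (hasSum_P₁.congr_fun fun j => ?_)
    simp only [integral_d1_mode hφ (hu.memLp j), mode_const_mul]
  · have hasSum_d2 := hasSum_integral_smul_mode α hu hφ.continuous_d2 hφ.compact_d2
    have hasSum_P₂ := (hasSum_integral_smul_mode α hv hφ.smooth.continuous hφ.compact).neg
    exact hasSum_d2.unique (hasSum_P₂.congr_fun fun j =>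
      integral_d2_mode hφ (hu.memLp j) (hv.memLp j) (huv j) _)

/-! ### Convolution with the Fourier coefficients of the Green's function -/

/-- The derivative of `greenKer k α j`. -/
def greenKerDeriv (k α : ℝ) (j : ℤ) (t : ℝ) : ℂ :=
  Complex.I / (4 * π) * Complex.I * sgnExpKer (betaJ k α j) t

theorem measurable_greenKerDeriv (k α : ℝ) (j : ℤ) : Measurable (greenKerDeriv k α j) :=
  (measurable_sgnExpKer _).const_mul _

theorem norm_greenKerDeriv_le (k α : ℝ) (j : ℤ) (t : ℝ) :
    ‖greenKerDeriv k α j t‖ ≤ ‖Complex.I / (4 * π) * Complex.I‖ := by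
  rw [greenKerDeriv, norm_mul, norm_sgnExpKer]
  exact mul_le_of_le_one_right (norm_nonneg _) (norm_expKer_le_one (betaJ_im_nonneg k α j) t)

theorem HasJumpDeriv.const_mul {u v : ℝ → ℂ} {c : ℂ} (h : HasJumpDeriv u v c) (a : ℂ) :
    HasJumpDeriv (fun t => a * u t) (fun t => a * v t) (a * c) := by
  intro ψ hψ hc
  simp only [← smul_eq_mul, smul_comm _ a, integral_smul, h ψ hψ hc, smul_neg, smul_sub]

section

variable {k α : ℝ} {j : ℤ} {h : ℝ → ℂ}

theorem hasJumpDeriv_greenKer (hres : k ^ 2 ≠ alphaJ α j ^ 2) :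
    HasJumpDeriv (greenKer k α j) (greenKerDeriv k α j) 0 := by
  have β_ne_zero := betaJ_ne_zero hres
  convert (hasJumpDeriv_expKer (betaJ k α j)).const_mul
    (Complex.I / (4 * π) * (betaJ k α j)⁻¹) using 1
  · rfl
  · funext t
    rw [greenKerDeriv]
    field_simp
  · rw [mul_zero]

theorem hasJumpDeriv_greenKerDeriv (hres : k ^ 2 ≠ alphaJ α j ^ 2) :
    HasJumpDeriv (greenKerDeriv k α j) (-betaJ k α j ^ 2 • greenKer k α j) (-(2 * π)⁻¹) := by
  have β_ne_zero := betaJ_ne_zero hres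
  have π_ne_zero : (π : ℂ) ≠ 0 := Complex.ofReal_ne_zero.2 Real.pi_ne_zero
  convert (hasJumpDeriv_sgnExpKer (betaJ k α j)).const_mul
    (Complex.I / (4 * π) * Complex.I) using 1
  · rfl
  · funext t
    rw [Pi.smul_apply, smul_eq_mul, greenKer]
    field_simp
    linear_combination -expKer (betaJ k α j) t * Complex.I_sq
  · push_cast
    field_simp
    linear_combination -4 * Complex.I_sq

theorem hasWeakDeriv_convolution_greenKer (hres : k ^ 2 ≠ alphaJ α j ^ 2)
    (hh : Integrable h) :
    HasWeakDeriv (h ⋆[mul ℂ ℂ] greenKer k α j) (h ⋆[mul ℂ ℂ] greenKerDeriv k α j) := by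
  simpa only [zero_mul, zero_add] using (hasJumpDeriv_greenKer hres).convolution
    (measurable_greenKer k α j) (norm_greenKer_le k α j) (measurable_greenKerDeriv k α j)
    (norm_greenKerDeriv_le k α j) hh

theorem hasWeakDeriv_convolution_greenKerDeriv (hres : k ^ 2 ≠ alphaJ α j ^ 2)
    (hh : Integrable h) :
    HasWeakDeriv (h ⋆[mul ℂ ℂ] greenKerDeriv k α j)
      fun t => -(2 * π)⁻¹ * h t + -betaJ k α j ^ 2 * (h ⋆[mul ℂ ℂ] greenKer k α j) t := by
  have := (hasJumpDeriv_greenKerDeriv hres).convolution (measurable_greenKerDeriv k α j)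
    (norm_greenKerDeriv_le k α j) ((measurable_greenKer k α j).const_smul _)
    (fun t => (norm_smul_le (-betaJ k α j ^ 2) _).trans (mul_le_mul_of_nonneg_left
      (norm_greenKer_le k α j t) (norm_nonneg _))) hh
  simpa only [convolution_smul, Pi.smul_apply, smul_eq_mul] using this

end

section

variable {k : ℝ} {h : ℤ → ℝ → ℂ} {S : Set ℝ} {c : ℤ → ℂ} {C : ℝ}

theorem IsL2Family.mul_of_norm_le {μ : Measure ℝ} [SFinite μ] {u : ℤ → ℝ → ℂ} {n : ℕ}
    (hu : IsL2Family (fun j t => wt j ^ n * u j t) μ) (hc : ∀ j, ‖c j‖ ≤ C * wt j ^ n) :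
    IsL2Family (fun j t => c j * u j t) μ := by
  have wt_ne_zero (j : ℤ) : (wt j : ℂ) ≠ 0 := Complex.ofReal_ne_zero.2 (wt_pos j).ne'
  have mul_eq (j : ℤ) (t : ℝ) : c j * u j t = c j / wt j ^ n * (wt j ^ n * u j t) := by
    rw [← mul_assoc, div_mul_cancel₀ _ (pow_ne_zero n (wt_ne_zero j))]
  simp only [mul_eq]
  refine hu.of_norm_le (C := C) (fun j => (hu.memLp j).1.const_mul _) fun j t => ?_
  rw [norm_mul, norm_div, norm_pow, norm_wt]
  gcongr
  exact (div_le_iff₀ (pow_pos (wt_pos j) n)).2 (hc j)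

theorem IsL2Family.mul_convolution_greenKer (hk : 0 < k) (α : ℝ) (hh : IsL2Family h volume)
    (hS : volume S ≠ ⊤) (h0 : ∀ j, ∀ s ∉ S, h j s = 0) (hc : ∀ j, ‖c j‖ ≤ C * wt j ^ 2) :
    IsL2Family (fun j t => c j * (h j ⋆[mul ℂ ℂ] greenKer k α j) t) lineMeas := by
  obtain ⟨C', hC'⟩ := exists_norm_inv_betaJ_mul_wt_le hk α
  have isL2Family_expKer := hh.convolution hk α hS h0 (K := fun j => expKer (betaJ k α j))
    (fun j => (continuous_expKer _).measurable) fun j t => rfl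
  have convolution_greenKer (j : ℤ) (t : ℝ) : (h j ⋆[mul ℂ ℂ] greenKer k α j) t =
      Complex.I / (4 * π) * (betaJ k α j)⁻¹ * (h j ⋆[mul ℂ ℂ] expKer (betaJ k α j)) t :=
    congrFun (convolution_smul (L := mul ℂ ℂ) (f := h j)) t
  simp only [convolution_greenKer, ← mul_assoc]
  refine IsL2Family.mul_of_norm_le (n := 1) (C := ‖Complex.I / (4 * π)‖ * (C * C'))
    (by simpa only [pow_one] using isL2Family_expKer) fun j => ?_
  have C_nonneg : 0 ≤ C := nonneg_of_mul_nonneg_left ((norm_nonneg _).trans (hc j))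
    (pow_pos (wt_pos j) 2)
  calc ‖c j * (Complex.I / (4 * π)) * (betaJ k α j)⁻¹‖
      = ‖Complex.I / (4 * π)‖ * (‖c j‖ * ‖(betaJ k α j)⁻¹‖) := by
        rw [norm_mul, norm_mul]; ring
    _ ≤ ‖Complex.I / (4 * π)‖ * (C * wt j ^ 2 * ‖(betaJ k α j)⁻¹‖) := by gcongr; exact hc j
    _ = ‖Complex.I / (4 * π)‖ * (C * (‖(betaJ k α j)⁻¹‖ * wt j) * wt j) := by ring
    _ ≤ ‖Complex.I / (4 * π)‖ * (C * C' * wt j) := by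
        have := (wt_pos j).le
        gcongr
        exact hC' j
    _ = ‖Complex.I / (4 * π)‖ * (C * C') * wt j ^ 1 := by ring

theorem IsL2Family.mul_convolution_greenKerDeriv (hk : 0 < k) (α : ℝ) (hh : IsL2Family h volume)
    (hS : volume S ≠ ⊤) (h0 : ∀ j, ∀ s ∉ S, h j s = 0) (hc : ∀ j, ‖c j‖ ≤ C * wt j) :
    IsL2Family (fun j t => c j * (h j ⋆[mul ℂ ℂ] greenKerDeriv k α j) t) lineMeas := by
  have isL2Family_sgnExpKer := hh.convolution hk α hS h0 (K := fun j => sgnExpKer (betaJ k α j))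
    (fun j => measurable_sgnExpKer _) fun j t => norm_sgnExpKer _ t
  have convolution_greenKerDeriv (j : ℤ) (t : ℝ) : (h j ⋆[mul ℂ ℂ] greenKerDeriv k α j) t =
      Complex.I / (4 * π) * Complex.I * (h j ⋆[mul ℂ ℂ] sgnExpKer (betaJ k α j)) t :=
    congrFun (convolution_smul (L := mul ℂ ℂ) (f := h j)) t
  simp only [convolution_greenKerDeriv, ← mul_assoc (c _)]
  refine IsL2Family.mul_of_norm_le (n := 1) (C := C * ‖Complex.I / (4 * π) * Complex.I‖)
    (by simpa only [pow_one] using isL2Family_sgnExpKer) fun j => ?_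
  rw [mul_assoc, norm_mul, pow_one, mul_right_comm]
  exact mul_le_mul_of_nonneg_right (hc j) (norm_nonneg _)

end

/-! ### The divergence of the volume potential -/

/-- The coefficient of `exp(iα_j x₁)` in the Fourier series of `div V_k g`, where `h i j` are the
Fourier coefficients of the `i`-th component of `g`. -/
def divCoef (k α : ℝ) (h : Fin 2 → ℤ → ℝ → ℂ) (j : ℤ) (t : ℝ) : ℂ :=
  Complex.I * alphaJ α j * (h 0 j ⋆[mul ℂ ℂ] greenKer k α j) t +
    (h 1 j ⋆[mul ℂ ℂ] greenKerDeriv k α j) t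

/-- The weak derivative of `divCoef k α h j`. -/
def divCoefDeriv (k α : ℝ) (h : Fin 2 → ℤ → ℝ → ℂ) (j : ℤ) (t : ℝ) : ℂ :=
  Complex.I * alphaJ α j * (h 0 j ⋆[mul ℂ ℂ] greenKerDeriv k α j) t +
    (-(2 * π)⁻¹ * h 1 j t + -betaJ k α j ^ 2 * (h 1 j ⋆[mul ℂ ℂ] greenKer k α j) t)

theorem norm_I_mul_alphaJ_le (α : ℝ) (j : ℤ) :
    ‖Complex.I * alphaJ α j‖ ≤ (1 + |α|) * wt j := by
  rw [norm_mul, Complex.norm_I, one_mul, Complex.norm_real]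
  exact abs_alphaJ_le α j

section

variable {k : ℝ} {h : Fin 2 → ℤ → ℝ → ℂ} {S : Set ℝ}

theorem isL2Family_mul_divCoef {c : ℤ → ℂ} {C : ℝ} (hk : 0 < k) (α : ℝ)
    (hh : ∀ i, IsL2Family (h i) volume) (hS : volume S ≠ ⊤) (h0 : ∀ i j, ∀ s ∉ S, h i j s = 0)
    (hc : ∀ j, ‖c j‖ ≤ C * wt j) :
    IsL2Family (fun j t => c j * divCoef k α h j t) lineMeas := by
  have norm_mul_le (j : ℤ) : ‖c j * (Complex.I * alphaJ α j)‖ ≤ C * (1 + |α|) * wt j ^ 2 := by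
    calc ‖c j * (Complex.I * alphaJ α j)‖
        ≤ C * wt j * ((1 + |α|) * wt j) := norm_mul_le_of_le (hc j) (norm_I_mul_alphaJ_le α j)
      _ = C * (1 + |α|) * wt j ^ 2 := by ring
  simpa only [divCoef, mul_add, ← mul_assoc] using
    ((hh 0).mul_convolution_greenKer hk α hS (h0 0) norm_mul_le).add
      ((hh 1).mul_convolution_greenKerDeriv hk α hS (h0 1) hc)

theorem isL2Family_divCoefDeriv (hk : 0 < k) (α : ℝ) (hh : ∀ i, IsL2Family (h i) volume)
    (hS : volume S ≠ ⊤) (h0 : ∀ i j, ∀ s ∉ S, h i j s = 0) :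
    IsL2Family (divCoefDeriv k α h) lineMeas := by
  have norm_sq_betaJ_le (j : ℤ) : ‖-betaJ k α j ^ 2‖ ≤ (k + 1 + |α|) ^ 2 * wt j ^ 2 := by
    rw [norm_neg, norm_pow, ← mul_pow]
    exact pow_le_pow_left₀ (norm_nonneg _) (norm_betaJ_le hk α j) 2
  have isL2Family_const_mul : IsL2Family (fun j t => -(2 * π)⁻¹ * h 1 j t) lineMeas :=
    have isL2Family_h := (hh 1).mono_measure lineMeas_le_volume
    isL2Family_h.of_norm_le (fun j => (isL2Family_h.memLp j).1.const_mul _)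
      fun j t => norm_mul_le _ _
  exact ((hh 0).mul_convolution_greenKerDeriv hk α hS (h0 0) (norm_I_mul_alphaJ_le α)).add
    (isL2Family_const_mul.add
      ((hh 1).mul_convolution_greenKer hk α hS (h0 1) norm_sq_betaJ_le))

theorem hasWeakDeriv_divCoef {α : ℝ} {j : ℤ} (hres : k ^ 2 ≠ alphaJ α j ^ 2)
    (hh : ∀ i, Integrable (h i j)) :
    HasWeakDeriv (divCoef k α h j) (divCoefDeriv k α h j) := by
  have locallyIntegrable_greenKer (i : Fin 2) :
      LocallyIntegrable (h i j ⋆[mul ℂ ℂ] greenKer k α j) :=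
    locallyIntegrable_convolution (hh i) (measurable_greenKer k α j) (norm_greenKer_le k α j)
  have locallyIntegrable_greenKerDeriv (i : Fin 2) :
      LocallyIntegrable (h i j ⋆[mul ℂ ℂ] greenKerDeriv k α j) :=
    locallyIntegrable_convolution (hh i) (measurable_greenKerDeriv k α j)
      (norm_greenKerDeriv_le k α j)
  have locallyIntegrable_mul {f : ℝ → ℂ} (hf : LocallyIntegrable f) (a : ℂ) :
      LocallyIntegrable fun t => a * f t := hf.smul a
  exact ((hasWeakDeriv_convolution_greenKer hres (hh 0)).const_mul _).add
    (hasWeakDeriv_convolution_greenKerDeriv hres (hh 1))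
    (locallyIntegrable_mul (locallyIntegrable_greenKer 0) _)
    (locallyIntegrable_mul (locallyIntegrable_greenKerDeriv 0) _)
    (locallyIntegrable_greenKerDeriv 1)
    ((locallyIntegrable_mul (hh 1).locallyIntegrable _).add
      (locallyIntegrable_mul (locallyIntegrable_greenKer 1) _))

theorem integral_smul_mode_divCoef {α : ℝ} {j : ℤ} (hres : k ^ 2 ≠ alphaJ α j ^ 2)
    (hh : ∀ i, Integrable (h i j)) {φ : ℝ × ℝ → ℝ} (hφ : IsTest univ φ) :
    ∫ x, φ x • mode (alphaJ α j) (divCoef k α h j) x =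
      -((∫ x, d1 φ x • mode (alphaJ α j) (h 0 j ⋆[mul ℂ ℂ] greenKer k α j) x) +
        ∫ x, d2 φ x • mode (alphaJ α j) (h 1 j ⋆[mul ℂ ℂ] greenKer k α j) x) := by
  have memLp_greenKer (i : Fin 2) : MemLp (h i j ⋆[mul ℂ ℂ] greenKer k α j) 2 lineMeas :=
    memLp_convolution (hh i) (measurable_greenKer k α j) (norm_greenKer_le k α j)
  have memLp_greenKerDeriv : MemLp (h 1 j ⋆[mul ℂ ℂ] greenKerDeriv k α j) 2 lineMeas :=
    memLp_convolution (hh 1) (measurable_greenKerDeriv k α j) (norm_greenKerDeriv_le k α j)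
  rw [integral_d1_mode hφ (memLp_greenKer 0), integral_d2_mode hφ (memLp_greenKer 1)
    memLp_greenKerDeriv (hasWeakDeriv_convolution_greenKer hres (hh 1)), ← neg_add, neg_neg,
    ← integral_add
      (integrable_test hφ.smooth.continuous hφ.compact (isL2Loc_of_memLp_planeMeas
        ((memLp_mode (memLp_greenKer 0) _).const_mul _)))
      (integrable_test hφ.smooth.continuous hφ.compact (isL2Loc_of_memLp_planeMeas
        (memLp_mode memLp_greenKerDeriv _)))]
  simp only [← smul_add, ← mode_const_mul]
  simp only [mode, divCoef, mul_add]

end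

theorem exists_div_volPot {k α ρ : ℝ} (hk : 0 < k) (hres : ∀ j : ℤ, k ^ 2 ≠ alphaJ α j ^ 2)
    {D : Set (ℝ × ℝ)} (hD : MeasurableSet D) (hDρ : D ⊆ box ρ) (g : L2v D) :
    ∃ U P, IsH1Loc U P ∧ IsQuasiPeriodic α U ∧ ∀ φ, IsTest univ φ →
      ∫ x, φ x • U x = -∫ x, (d1 φ x • volPot k α D g x 0 + d2 φ x • volPot k α D g x 1) := by
  set h : Fin 2 → ℤ → ℝ → ℂ := fun i => fourierCoef α fun x => D.indicator g x i
  have isDensity_g (i : Fin 2) := IsDensity.indicator_apply hD hDρ g i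
  have isL2Family_h (i : Fin 2) : IsL2Family (h i) volume :=
    (isDensity_g i).isL2Family_fourierCoef α
  have integrable_h (i : Fin 2) (j : ℤ) : Integrable (h i j) :=
    (isDensity_g i).integrable_fourierCoef α j
  have h_eq_zero (i : Fin 2) (j : ℤ) (s : ℝ) (hs : s ∉ Ioo (-ρ) ρ) : h i j s = 0 :=
    (isDensity_g i).fourierCoef_eq_zero α j hs
  have volume_Ioo_ne_top : volume (Ioo (-ρ) ρ) ≠ ⊤ := measure_Ioo_lt_top.ne
  have isL2Family_divCoef : IsL2Family (divCoef k α h) lineMeas := by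
    simpa only [one_mul] using isL2Family_mul_divCoef (c := fun _ => 1) (C := 1) hk α isL2Family_h
      volume_Ioo_ne_top h_eq_zero fun j => by simpa using one_le_wt j
  obtain ⟨U, P, isH1Loc_U, isQuasiPeriodic_U, hasSum_U⟩ := exists_isH1Loc_of_isL2Family α
    isL2Family_divCoef
    (isL2Family_mul_divCoef hk α isL2Family_h volume_Ioo_ne_top h_eq_zero (norm_I_mul_alphaJ_le α))
    (isL2Family_divCoefDeriv hk α isL2Family_h volume_Ioo_ne_top h_eq_zero)
    fun j => hasWeakDeriv_divCoef (hres j) fun i => integrable_h i j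
  refine ⟨U, P, isH1Loc_U, isQuasiPeriodic_U, fun φ hφ => ?_⟩
  have isCutoff_d1 := isCutoff_of_continuous hφ.continuous_d1 hφ.compact_d1
  have isCutoff_d2 := isCutoff_of_continuous hφ.continuous_d2 hφ.compact_d2
  have integrable_coord {ψ : ℝ × ℝ → ℝ} (hψ : IsCutoff ψ) (i : Fin 2) :
      Integrable fun x => ψ x • volPot k α D g x i :=
    (EuclideanSpace.proj (𝕜 := ℂ) i).integrable_comp (hψ.integrable_smul_volPot hk α hD hDρ g)
  rw [integral_add (integrable_coord isCutoff_d1 0) (integrable_coord isCutoff_d2 1)]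
  refine (hasSum_U φ hφ.smooth.continuous hφ.compact).unique ?_
  refine ((isCutoff_d1.hasSum_integral_smul_volPot hk α hD hDρ g 0).add
    (isCutoff_d2.hasSum_integral_smul_volPot hk α hD hDρ g 1)).neg.congr_fun fun j => ?_
  exact integral_smul_mode_divCoef (hres j) (fun i => integrable_h i j) hφ

/-! ### Existence of `L_k g` -/

theorem IsTest.mono {D E : Set (ℝ × ℝ)} {φ : ℝ × ℝ → ℝ} (h : IsTest D φ) (hDE : D ⊆ E) :
    IsTest E φ := ⟨h.smooth, h.compact, h.supp.trans hDE⟩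

section

variable {D : Set (ℝ × ℝ)} {φ : ℝ × ℝ → ℝ} {x : ℝ × ℝ}

theorem IsTest.eq_zero (h : IsTest D φ) (hx : x ∉ D) : φ x = 0 :=
  image_eq_zero_of_notMem_tsupport fun hx' => hx (h.supp hx')

theorem IsTest.fderiv_eq_zero (h : IsTest D φ) (hx : x ∉ D) : fderiv ℝ φ x = 0 :=
  image_eq_zero_of_notMem_tsupport fun hx' => hx (h.supp (tsupport_fderiv_subset ℝ hx'))

theorem IsTest.d1_eq_zero (h : IsTest D φ) (hx : x ∉ D) : d1 φ x = 0 := by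
  rw [d1, h.fderiv_eq_zero hx, zero_apply]

theorem IsTest.d2_eq_zero (h : IsTest D φ) (hx : x ∉ D) : d2 φ x = 0 := by
  rw [d2, h.fderiv_eq_zero hx, zero_apply]

end

theorem exists_H1_of_isH1Loc {α : ℝ} {D : Set (ℝ × ℝ)} (hD : Bornology.IsBounded D)
    {U : ℝ × ℝ → ℂ} {P : ℝ × ℝ → C2} (hU : IsH1Loc U P) (hα : IsQuasiPeriodic α U) :
    ∃ w : H1 D α, ∀ᵐ x ∂(volume.restrict D), w.fn x = U x := by
  have memLp_U : MemLp U 2 (volume.restrict D) :=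
    (hU.fn _ hD.isCompact_closure).mono_measure (Measure.restrict_mono subset_closure le_rfl)
  have memLp_P : MemLp P 2 (volume.restrict D) :=
    (hU.grad _ hD.isCompact_closure).mono_measure (Measure.restrict_mono subset_closure le_rfl)
  exact ⟨⟨WithLp.toLp 2 (memLp_U.toLp U, memLp_P.toLp P), U, P, hU, hα, memLp_U.coeFn_toLp,
    memLp_P.coeFn_toLp⟩, memLp_U.coeFn_toLp⟩

theorem exists_isLk {k α ρ : ℝ} (hk : 0 < k) (hres : ∀ j : ℤ, k ^ 2 ≠ alphaJ α j ^ 2)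
    {D : Set (ℝ × ℝ)} (hD : MeasurableSet D) (hDρ : D ⊆ box ρ) (g : L2v D) :
    ∃ w : H1 D α, IsLk k α D g w := by
  have isBounded_D : Bornology.IsBounded D :=
    ((Metric.isBounded_Ioo _ _).prod (Metric.isBounded_Ioo _ _)).subset hDρ
  obtain ⟨U, P, hU, hα, hdiv⟩ := exists_div_volPot hk hres hD hDρ g
  obtain ⟨w, hw⟩ := exists_H1_of_isH1Loc isBounded_D hU hα
  refine ⟨w, (locallyIntegrable_volPot hk α hD hDρ g).locallyIntegrableOn _, fun φ hφ => ?_⟩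
  calc ∫ x in D, φ x • w.fn x
      = ∫ x in D, φ x • U x := integral_congr_ae (hw.mono fun x hx => congrArg (φ x • ·) hx)
    _ = ∫ x, φ x • U x := setIntegral_eq_integral_of_forall_compl_eq_zero fun x hx => by
        rw [hφ.eq_zero hx, zero_smul]
    _ = -∫ x, (d1 φ x • volPot k α D g x 0 + d2 φ x • volPot k α D g x 1) :=
        hdiv φ (hφ.mono (subset_univ D))
    _ = -∫ x in D, (d1 φ x • volPot k α D g x 0 + d2 φ x • volPot k α D g x 1) := by
        rw [setIntegral_eq_integral_of_forall_compl_eq_zero fun x hx => by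
          rw [hφ.d1_eq_zero hx, hφ.d2_eq_zero hx, zero_smul, zero_smul, add_zero]]

/-! ### Uniqueness of `L_k g` -/

theorem ae_eq_zero_of_integral_isTest_smul_eq_zero {D : Set (ℝ × ℝ)} (hD : IsOpen D)
    {f : ℝ × ℝ → ℂ} (hf : IntegrableOn f D) (h : ∀ φ, IsTest D φ → ∫ x in D, φ x • f x = 0) :
    ∀ᵐ x ∂(volume.restrict D), f x = 0 := by
  rw [ae_restrict_iff' hD.measurableSet]
  refine hD.ae_eq_zero_of_integral_contDiff_smul_eq_zero hf.locallyIntegrableOn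
    fun φ smooth compact supp => ?_
  have isTest_φ : IsTest D φ := ⟨smooth, compact, supp⟩
  rw [← h φ isTest_φ, setIntegral_eq_integral_of_forall_compl_eq_zero fun x hx => by
    rw [isTest_φ.eq_zero hx, zero_smul]]

theorem IsH1Loc.setIntegral_smul_grad_eq_zero {U : ℝ × ℝ → ℂ} {P : ℝ × ℝ → C2} (h : IsH1Loc U P)
    {D : Set (ℝ × ℝ)} (hD : MeasurableSet D) (hU : ∀ᵐ x ∂(volume.restrict D), U x = 0)
    {φ : ℝ × ℝ → ℝ} (hφ : IsTest D φ) (i : Fin 2) : ∫ x in D, φ x • P x i = 0 := by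
  rw [setIntegral_eq_integral_of_forall_compl_eq_zero fun x hx => by
    rw [hφ.eq_zero hx, zero_smul]]
  have isTest_univ := hφ.mono (subset_univ D)
  have integral_smul_eq_zero {ψ : ℝ × ℝ → ℝ} (hψ : ∀ x ∉ D, ψ x = 0) : ∫ x, ψ x • U x = 0 := by
    refine integral_eq_zero_of_ae ?_
    filter_upwards [(ae_restrict_iff' hD).1 hU] with x hUx
    by_cases hx : x ∈ D
    · rw [hUx hx, smul_zero, Pi.zero_apply]
    · rw [hψ x hx, zero_smul, Pi.zero_apply]
  fin_cases i
  · exact neg_eq_zero.1 ((h.weak1 φ isTest_univ).symm.trans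
      (integral_smul_eq_zero fun x hx => hφ.d1_eq_zero hx))
  · exact neg_eq_zero.1 ((h.weak2 φ isTest_univ).symm.trans
      (integral_smul_eq_zero fun x hx => hφ.d2_eq_zero hx))

theorem IsH1Loc.grad_eq_zero {U : ℝ × ℝ → ℂ} {P : ℝ × ℝ → C2} (h : IsH1Loc U P)
    {D : Set (ℝ × ℝ)} (hD : IsOpen D) (hU : ∀ᵐ x ∂(volume.restrict D), U x = 0)
    (hP : IntegrableOn P D) : ∀ᵐ x ∂(volume.restrict D), P x = 0 := by
  have ae_coord_eq_zero : ∀ᵐ x ∂(volume.restrict D), ∀ i, P x i = 0 :=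
    ae_all_iff.2 fun i => ae_eq_zero_of_integral_isTest_smul_eq_zero hD
      ((EuclideanSpace.proj (𝕜 := ℂ) i).integrable_comp hP)
      fun φ hφ => h.setIntegral_smul_grad_eq_zero hD.measurableSet hU hφ i
  exact ae_coord_eq_zero.mono fun x hx => PiLp.ext hx

theorem integrableOn_Lp {E : Type*} [NormedAddCommGroup E] {D : Set (ℝ × ℝ)}
    (hD : volume D ≠ ⊤) (f : Lp E 2 ((volume : Measure (ℝ × ℝ)).restrict D)) : IntegrableOn f D :=
  have : IsFiniteMeasure ((volume : Measure (ℝ × ℝ)).restrict D) := isFiniteMeasure_restrict.2 hD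
  (Lp.memLp f).integrable one_le_two

theorem H1.eq_zero_of_fn_eq_zero {D : Set (ℝ × ℝ)} (hD : IsOpen D) (hfin : volume D ≠ ⊤) {α : ℝ}
    {w : H1 D α} (hw : w.fn = 0) : w = 0 := by
  obtain ⟨U, P, isH1Loc_U, -, fn_eq, grad_eq⟩ := w.2
  have ae_U_eq_zero : ∀ᵐ x ∂(volume.restrict D), U x = 0 := by
    filter_upwards [fn_eq, Lp.eq_zero_iff_ae_eq_zero.1 hw] with x fn_eq_U fn_eq_zero
    exact fn_eq_U.symm.trans fn_eq_zero
  have ae_P_eq_zero := isH1Loc_U.grad_eq_zero hD ae_U_eq_zero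
    ((integrableOn_Lp hfin w.grad).congr grad_eq)
  have grad_eq_zero : w.grad = 0 :=
    Lp.eq_zero_iff_ae_eq_zero.2 (Filter.EventuallyEq.trans grad_eq ae_P_eq_zero)
  exact Subtype.ext (WithLp.ofLp_injective 2 (Prod.ext hw grad_eq_zero))

theorem IsLk.unique {k α : ℝ} {D : Set (ℝ × ℝ)} (hD : IsOpen D) (hfin : volume D ≠ ⊤) {g : L2v D}
    {w w' : H1 D α} (h : IsLk k α D g w) (h' : IsLk k α D g w') : w = w' := by
  have integrable_smul {φ : ℝ × ℝ → ℝ} (hφ : IsTest D φ) (u : H1 D α) :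
      IntegrableOn (fun x => φ x • u.fn x) D :=
    ((integrableOn_Lp hfin u.fn).locallyIntegrable).integrable_smul_left_of_hasCompactSupport
      hφ.smooth.continuous hφ.compact
  have ae_sub_eq_zero : ∀ᵐ x ∂(volume.restrict D), w.fn x - w'.fn x = 0 := by
    refine ae_eq_zero_of_integral_isTest_smul_eq_zero hD
      ((integrableOn_Lp hfin w.fn).sub (integrableOn_Lp hfin w'.fn)) fun φ hφ => ?_
    simp only [smul_sub]
    rw [integral_sub (integrable_smul hφ w) (integrable_smul hφ w'), h.weakDiv φ hφ,
      h'.weakDiv φ hφ, sub_self]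
  have fn_eq : w.fn = w'.fn := Lp.ext (ae_sub_eq_zero.mono fun x hx => sub_eq_zero.1 hx)
  exact sub_eq_zero.1 (H1.eq_zero_of_fn_eq_zero hD hfin (sub_eq_zero.2 fn_eq))

/-! ### The weight `|Re Q|^{1/2}` -/

theorem act_mul (A B : Matrix (Fin 2) (Fin 2) ℂ) (ξ : C2) : act (A * B) ξ = act A (act B ξ) := by
  rw [act, map_mul, mul_apply_eq_comp, act, act]

theorem act_one (ξ : C2) : act 1 ξ = ξ := by
  rw [act, map_one, one_apply_eq_self]

section

variable {A B : Matrix (Fin 2) (Fin 2) ℂ}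

theorem inner_act_left (hA : IsSelfAdjoint A) (ξ η : C2) :
    inner ℂ (act A ξ) η = inner ℂ ξ (act A η) :=
  ContinuousLinearMap.isSelfAdjoint_iff_isSymmetric.1
    (hA.map (Matrix.toEuclideanCLM (n := Fin 2) (𝕜 := ℂ))) ξ η

theorem norm_act_eq_norm_act (hA : IsSelfAdjoint A) (hB : IsSelfAdjoint B) (h : A * A = B * B)
    (ξ : C2) : ‖act A ξ‖ = ‖act B ξ‖ := by
  have inner_eq : inner ℂ (act A ξ) (act A ξ) = inner ℂ (act B ξ) (act B ξ) := by
    rw [inner_act_left hA, inner_act_left hB, ← act_mul, ← act_mul, h]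
  rw [norm_eq_sqrt_re_inner (𝕜 := ℂ), inner_eq, ← norm_eq_sqrt_re_inner]

end

section

variable (A : Matrix (Fin 2) (Fin 2) ℂ)

theorem sqrtAbsRe_mul_self : sqrtAbsRe A * sqrtAbsRe A = cfc (fun t : ℝ => |t|) (reM A) := by
  rw [sqrtAbsRe, ← cfc_mul _ _ _]
  exact cfc_congr fun t _ => Real.mul_self_sqrt (abs_nonneg t)

theorem sqrtAbsRe_mul_self_mul_self :
    (sqrtAbsRe A * sqrtAbsRe A) * (sqrtAbsRe A * sqrtAbsRe A) = reM A * reM A := by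
  rw [sqrtAbsRe_mul_self, ← cfc_mul _ _ _]
  simp only [abs_mul_abs_self]
  rw [cfc_mul _ _ _, cfc_id' ℝ (reM A) (isSelfAdjoint_reM A)]

theorem norm_act_reM (ξ : C2) :
    ‖act (reM A) ξ‖ = ‖act (sqrtAbsRe A) (act (sqrtAbsRe A) ξ)‖ := by
  rw [← act_mul]
  refine norm_act_eq_norm_act (isSelfAdjoint_reM A) ?_ (sqrtAbsRe_mul_self_mul_self A).symm ξ
  rw [sqrtAbsRe_mul_self]
  exact cfc_predicate _ _

theorem reM_add_imM : reM A + Complex.I • imM A = A := by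
  ext i j
  simp only [reM, imM, Matrix.add_apply, Matrix.smul_apply, Matrix.sub_apply, smul_eq_mul]
  field_simp
  ring

theorem act_eq_reM_add_imM (ξ : C2) :
    act A ξ = act (reM A) ξ + Complex.I • act (imM A) ξ := by
  conv_lhs => rw [← reM_add_imM A]
  rw [act, map_add, map_smul, add_apply, smul_apply, act,
    act]

end

theorem isUnit_det_sqrtAbsRe {A : Matrix (Fin 2) (Fin 2) ℂ} (hA : IsUnit (reM A).det) :
    IsUnit (sqrtAbsRe A).det := by
  have isUnit_det_mul := hA.mul hA
  rw [← Matrix.det_mul, ← sqrtAbsRe_mul_self_mul_self, Matrix.det_mul, Matrix.det_mul]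
    at isUnit_det_mul
  exact isUnit_of_mul_isUnit_left (isUnit_of_mul_isUnit_left isUnit_det_mul)

open scoped ComplexOrder in
theorem Contrast.isUnit_det_sqrtAbsRe {D : Set (ℝ × ℝ)} (Q : Contrast D) :
    ∀ᵐ x ∂(volume.restrict D), IsUnit (sqrtAbsRe (Q.toFun x)).det := by
  filter_upwards [Q.definite] with x definite
  refine Grating.isUnit_det_sqrtAbsRe ((Matrix.isUnit_iff_isUnit_det _).1 ?_)
  rcases definite with posDef | neg_posDef
  · exact posDef.isUnit
  · exact IsUnit.neg_iff _ |>.1 neg_posDef.isUnit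

/-! ### The weighted space `H¹_{α,Q}(D)` -/

theorem aestronglyMeasurable_matrix_inv {X : Type*} [MeasurableSpace X] {μ : Measure X}
    {ι 𝕜 : Type*} [Fintype ι] [DecidableEq ι] [RCLike 𝕜] {A : X → Matrix ι ι 𝕜}
    (hA : AEStronglyMeasurable A μ) : AEStronglyMeasurable (fun x => (A x)⁻¹) μ := by
  simp only [Matrix.inv_def, Ring.inverse_eq_inv']
  exact (continuous_id.matrix_det.comp_aestronglyMeasurable hA).inv₀.smul
    (continuous_id.matrix_adjugate.comp_aestronglyMeasurable hA)

section

variable {D : Set (ℝ × ℝ)} {α k : ℝ} {Q : Contrast D}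

theorem weightMapQ_toH1Q (u : H1 D α) : weightMapQ α Q (u.toH1Q Q) = weightMap α Q u :=
  ContinuousLinearMap.fromCompletion_apply_coe _ _

theorem gradQ_toH1Q (u : H1 D α) : gradQ (u.toH1Q Q) =ᵐ[volume.restrict D] u.grad := by
  have weightMap_snd : (weightMap α Q u).snd = (Q.memLp u.grad).toLp _ := rfl
  filter_upwards [Q.isUnit_det_sqrtAbsRe, (Q.memLp u.grad).coeFn_toLp] with x isUnit_det coe_eq
  rw [gradQ, weightMapQ_toH1Q, weightMap_snd, coe_eq, ← act_mul,
    Matrix.nonsing_inv_mul _ isUnit_det, act_one]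

theorem SolvesH1.toH1Q {f : L2v D} {u : H1 D α} (h : SolvesH1 k Q f u) :
    SolvesH1Q k Q f (u.toH1Q Q) := by
  obtain ⟨g, g_eq, isLk⟩ := h
  refine ⟨g, ?_, u, isLk, rfl⟩
  filter_upwards [g_eq, gradQ_toH1Q u] with x g_eq gradQ_eq
  rw [g_eq, gradQ_eq]

theorem SolvesH1Q.exists_solvesH1 {f : L2v D} {v : H1Q α Q} (h : SolvesH1Q k Q f v) :
    ∃ u : H1 D α, u.toH1Q Q = v ∧ SolvesH1 k Q f u := by
  obtain ⟨g, g_eq, u, isLk, rfl⟩ := h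
  refine ⟨u, rfl, g, ?_, isLk⟩
  filter_upwards [g_eq, gradQ_toH1Q u] with x g_eq gradQ_eq
  rw [g_eq, gradQ_eq]

theorem act_sqrtAbsRe_gradQ (v : H1Q α Q) :
    (fun x => act (sqrtAbsRe (Q.toFun x)) (gradQ v x)) =ᵐ[volume.restrict D]
      (weightMapQ α Q v).snd := by
  filter_upwards [Q.isUnit_det_sqrtAbsRe] with x isUnit_det
  rw [gradQ, ← act_mul, Matrix.mul_nonsing_inv _ isUnit_det, act_one]

theorem aestronglyMeasurable_gradQ (v : H1Q α Q) :
    AEStronglyMeasurable (gradQ v) (volume.restrict D) :=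
  aestronglyMeasurable_act (aestronglyMeasurable_matrix_inv Q.aestronglyMeasurable_sqrt)
    (Lp.aestronglyMeasurable (weightMapQ α Q v).snd)

theorem memLp_act_gradQ {C : ℝ} (h : ∀ᵐ x ∂(volume.restrict D), ∀ ξ : C2,
      ‖act (imM (Q.toFun x)) ξ‖ ≤ C * ‖act (reM (Q.toFun x)) ξ‖) (v : H1Q α Q) :
    MemLp (fun x => act (Q.toFun x) (gradQ v x)) 2 (volume.restrict D) := by
  refine MemLp.of_le_mul (c := 1 + C) (Q.memLp (weightMapQ α Q v).snd)
    (aestronglyMeasurable_act Q.aestronglyMeasurable (aestronglyMeasurable_gradQ v)) ?_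
  filter_upwards [h, act_sqrtAbsRe_gradQ v] with x norm_imM_le act_gradQ_eq
  calc ‖act (Q.toFun x) (gradQ v x)‖
      ≤ ‖act (reM (Q.toFun x)) (gradQ v x)‖ + ‖act (imM (Q.toFun x)) (gradQ v x)‖ := by
        rw [act_eq_reM_add_imM]
        refine (norm_add_le _ _).trans_eq ?_
        rw [norm_smul, Complex.norm_I, one_mul]
    _ ≤ (1 + C) * ‖act (reM (Q.toFun x)) (gradQ v x)‖ := by linarith [norm_imM_le (gradQ v x)]
    _ = (1 + C) * ‖act (sqrtAbsRe (Q.toFun x)) ((weightMapQ α Q v).snd x)‖ := by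
        rw [norm_act_reM, act_gradQ_eq]

end

end Grating

end

theorem mainTheorem9 (k α ρ : ℝ) (hk : 0 < k)
    (hres : ∀ j : ℤ, k ^ 2 ≠ Grating.alphaJ α j ^ 2)
    (D : Set (ℝ × ℝ)) (hD : IsOpen D)
    (hDρ : D ⊆ Set.Ioo (-Real.pi) Real.pi ×ˢ Set.Ioo (-ρ) ρ)
    (Q : Grating.Contrast D) (f : Grating.L2v D) :
    -- the operator `L_k` from `L²(D, ℂ²)` to `H¹_α(D)` is well defined
    (∀ g : Grating.L2v D, ∃! w : Grating.H1 D α, Grating.IsLk k α D g w) ∧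
    -- solutions in `H¹_α(D)` are solutions in `H¹_{α,Q}(D)`
    (∀ u : Grating.H1 D α, Grating.SolvesH1 k Q f u → Grating.SolvesH1Q k Q f (u.toH1Q Q)) ∧
    -- solutions in `H¹_{α,Q}(D)` belong to `H¹_α(D)` and are solutions there
    (∀ v : Grating.H1Q α Q, Grating.SolvesH1Q k Q f v →
      ∃ u : Grating.H1 D α, u.toH1Q Q = v ∧ Grating.SolvesH1 k Q f u) ∧
    -- if `|Im Q ξ| ≤ C |Re Q ξ|`, then `Q∇v` is in `L²(D, ℂ²)` for every `v` in `H¹_{α,Q}(D)`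
    ((∃ C : ℝ, 0 < C ∧ ∀ᵐ x ∂(MeasureTheory.volume.restrict D), ∀ ξ : Grating.C2,
        ‖Grating.act (Grating.imM (Q.toFun x)) ξ‖ ≤
          C * ‖Grating.act (Grating.reM (Q.toFun x)) ξ‖) →
      ∀ v : Grating.H1Q α Q, MeasureTheory.MemLp
        (fun x => Grating.act (Q.toFun x) (Grating.gradQ v x)) 2
        (MeasureTheory.volume.restrict D)) := by
  refine ⟨fun g => ?_, fun u hu => hu.toH1Q, fun v hv => hv.exists_solvesH1, ?_⟩
  · obtain ⟨w, hw⟩ := Grating.exists_isLk hk hres hD.measurableSet hDρ g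
    have volume_ne_top : MeasureTheory.volume D ≠ ⊤ :=
      ((MeasureTheory.measure_mono hDρ).trans_lt (Grating.volume_box_lt_top ρ)).ne
    exact ⟨w, hw, fun w' hw' => hw'.unique hD volume_ne_top hw⟩
  · rintro ⟨C, -, norm_imM_le⟩ v
    exact Grating.memLp_act_gradQ norm_imM_le v
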